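/- Let $n\ge 1$ and let $M$ be a smooth (Hausdorff, second countable) manifold of dimension $n$. A codimension-$1$ divergence-free $n$-web $\mathcal W_\Omega=(M,\mathcal F_1,\dots,\mathcal F_n,\Omega)$ on $M$ consists of $n$ smooth codimension-$1$ foliations $\mathcal F_1,\dots,\mathcal F_n$ of $M$ in general position, i.e. $\operatorname{codim}\bigcap_i T_p\mathcal F_i=\sum_i\operatorname{codim}T_p\mathcal F_i$ for all $p\in M$, and a smooth nowhere-vanishing $n$-form $\Omega$ on $M$. A $\mathcal W_\Omega$-adapted coframe on an open set is a smooth coframe $(\xi^1,\dots,\xi^n)$ with $T\mathcal F_i=\ker\xi^i$ for all $i$ and $\Omega=\xi^1\wedge\dots\wedge\xi^n$. A $\mathcal W_\Omega$-connection is a smooth torsionless affine connection on $M$ whose connection forms $\theta^j_k$ (given by $\nabla e_k=\sum_j\theta^j_k\otimes e_j$ for the dual frame $(e_k)$) satisfy, with respect to each adapted coframe, $\theta^j_k=0$ for $j\ne k$ (the $\mathcal F_i$ are parallel) and $\sum_k\theta^k_k=0$ ($\Omega$ is parallel). Its curvature is $R(X,Y)Z=\nabla_X\nabla_YZ-\nabla_Y\nabla_XZ-\nabla_{[X,Y]}Z$,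 and its Ricci tensor is taken with the convention $\mathrm{Rc}(X,Z)=\operatorname{tr}\bigl(Y\mapsto R(X,Y)Z\bigr)$. The connection is flat if $R=0$, and Ricci-flat if $\mathrm{Rc}=0$. $\mathcal W_\Omega$-adapted coordinates are coordinates $(x_1,\dots,x_n)$ mapping an open set onto an open box, in which the plaques of $\mathcal F_i$ are the slices $x_i=\mathrm{const}$, for each $i$. The nonuniformity tensor of $\mathcal W_\Omega$ is the symmetric $2$-tensor field given in any adapted coordinates by $$\mathcal K(\mathcal W_\Omega)=\sum_{i\ne j}\frac{\partial^2\log|h|}{\partial x_i\,\partial x_j}\,dx_i\,dx_j,\qquad \Omega=h\,dx_1\wedge\dots\wedge dx_n .$$ The web $\mathcal W_\Omega$ is locally trivial if for each $p\in M$ there is a diffeomorphism $\Phi$ from an open neighbourhood $U$ of $p$ onto an open neighbourhood $V$ of $0\in\mathbb R^n$ with $\Phi(p)=0$ which, for some permutation $\sigma$ and every $j$, carries the leaves of $\mathcal F_j|_U$ onto the leaves of the restriction to $V$ of the foliation of $\mathbb R^n$ by the hyperplanes $x_{\sigma(j)}=\mathrm{const}$, and satisfies $\Phi^*(dx_1\wedge\dots\wedge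 dx_n)=\Omega$. Theorem. Let $\mathcal W_\Omega$ be a codimension-$1$ divergence-free $n$-web on $M$. Then: 1. Around every point there are $\mathcal W_\Omega$-adapted coordinates centred at that point, and $\mathcal K(\mathcal W_\Omega)$ does not depend on the choice of adapted coordinates. 2. A $\mathcal W_\Omega$-connection exists and is unique. 3. The Ricci tensor $\mathrm{Rc}$ of the $\mathcal W_\Omega$-connection equals $\mathcal K(\mathcal W_\Omega)$. 4. The following are equivalent: (a) $\mathcal W_\Omega$ is locally trivial; (b) the $\mathcal W_\Omega$-connection is flat; (c) the $\mathcal W_\Omega$-connection is Ricci-flat. -/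

import Mathlib

open scoped Manifold ContDiff Topology Bundle

noncomputable section

/-- `n`-dimensional Euclidean space, the model space of all manifolds considered here. -/
abbrev Euc (n : ℕ) : Type := EuclideanSpace ℝ (Fin n)

/-- The tangent space `T_p M` of an `n`-dimensional smooth manifold without boundary. -/
abbrev Tan (n : ℕ) {M : Type*} [TopologicalSpace M] [ChartedSpace (Euc n) M] (p : M) : Type :=
  TangentSpace 𝓘(ℝ, Euc n) p

/-- The `k`-th vector of the standard basis of `ℝⁿ`. -/
def stdVec {n : ℕ} (k : Fin n) : Euc n := EuclideanSpace.single k (1 : ℝ)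

/-- Open boxes `∏ (aₖ, bₖ)` in `ℝⁿ`. -/
def IsOpenBox {n : ℕ} (s : Set (Euc n)) : Prop :=
  ∃ a b : Fin n → ℝ, s = {x | ∀ k, a k < x k ∧ x k < b k}

section Foliations

variable {n : ℕ} {M : Type*} [TopologicalSpace M] [ChartedSpace (Euc n) M]

/-- Given a partition of `M` into leaves, encoded by an equivalence relation, `leafIn r U x` is the
leaf through `x` of the partition restricted to `U`: the path component of `x` in the intersection
of `U` with the leaf of `x`. For a foliation and the domain `U` of a foliated chart, these are the
plaques in `U`. -/
def leafIn (r : Setoid M) (U : Set M) (x : M) : Set M :=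
  pathComponentIn ({y | r x y} ∩ U) x

/-- The smooth cubical chart `φ` is foliated, with transverse coordinate `xᵢ`: the plaques in its
domain are exactly the slices `xᵢ = const`. -/
structure IsFoliatedChart (r : Setoid M) (φ : OpenPartialHomeomorph M (Euc n)) (i : Fin n) :
    Prop where
  mem_atlas : φ ∈ IsManifold.maximalAtlas 𝓘(ℝ, Euc n) ∞ M
  cubical : IsOpenBox φ.target
  plaque : ∀ x ∈ φ.source, leafIn r φ.source x = {y | y ∈ φ.source ∧ φ y i = φ x i}

/-- The differential `dxₖ` at `p` of the `k`-th coordinate function of the chart `φ`. -/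
def coordDiff (φ : OpenPartialHomeomorph M (Euc n)) (k : Fin n) (p : M) : Tan n p →L[ℝ] ℝ :=
  (EuclideanSpace.proj k : Euc n →L[ℝ] ℝ) ∘L
    (mfderiv 𝓘(ℝ, Euc n) 𝓘(ℝ, Euc n) φ p : Tan n p →L[ℝ] Euc n)

/-- The tangent space at `p` of the foliation with leaf relation `r`: the vectors annihilated by
the differentials of the transverse coordinates of the foliated charts around `p`. -/
def leafTangent (r : Setoid M) (p : M) : Submodule ℝ (Tan n p) :=
  ⨅ (φ : OpenPartialHomeomorph M (Euc n)) (i : Fin n)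
    (_ : IsFoliatedChart r φ i) (_ : p ∈ φ.source), LinearMap.ker (coordDiff φ i p).toLinearMap

variable (n M) in
/-- A smooth foliation of codimension one of an `n`-manifold: a decomposition of `M` into
path-connected leaves such that `M` is covered by foliated charts. -/
structure Foliation where
  /-- `leafRel x y` means that `x` and `y` lie on the same leaf. -/
  leafRel : Setoid M
  leaf_pathConnected : ∀ x, IsPathConnected {y | leafRel x y}
  exists_chart : ∀ p : M, ∃ (φ : OpenPartialHomeomorph M (Euc n)) (i : Fin n),
    p ∈ φ.source ∧ IsFoliatedChart leafRel φ i

/-- The tangent space `T_p F` of a foliation. -/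
abbrev Foliation.tangent (F : Foliation n M) (p : M) : Submodule ℝ (Tan n p) :=
  leafTangent F.leafRel p

end Foliations

section Webs

variable (n : ℕ) (M : Type*) [TopologicalSpace M] [ChartedSpace (Euc n) M]
  [IsManifold 𝓘(ℝ, Euc n) ∞ M]

/-- A divergence-free `n`-web of codimension one on an `n`-dimensional manifold `M`: codimension-one
foliations `F₁, …, Fₙ` in general position, together with a smooth nowhere vanishing form of top
degree. -/
structure DivFreeWeb where
  fol : Fin n → Foliation n M
  /-- `codim (⋂ᵢ T_p Fᵢ) = ∑ᵢ codim T_p Fᵢ` -/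
  general_position : ∀ p : M,
    Module.finrank ℝ (Tan n p ⧸ ⨅ i, (fol i).tangent p) =
      ∑ i, Module.finrank ℝ (Tan n p ⧸ (fol i).tangent p)
  /-- The volume form `Ω`. -/
  vol : (p : M) → (Tan n p) [⋀^Fin n]→ₗ[ℝ] ℝ
  vol_smooth : ∀ (U : Set M) (X : Fin n → (p : M) → Tan n p), IsOpen U →
    (∀ k, ContMDiffOn 𝓘(ℝ, Euc n) 𝓘(ℝ, Euc n).tangent ∞
      (fun p => (⟨p, X k p⟩ : TangentBundle 𝓘(ℝ, Euc n) M)) U) →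
    ContMDiffOn 𝓘(ℝ, Euc n) 𝓘(ℝ, ℝ) ∞ (fun p => vol p (fun k => X k p)) U
  vol_ne_zero : ∀ p, vol p ≠ 0

end Webs

section StandardWeb

variable {n : ℕ}

/-- The foliation of `ℝⁿ` by the hyperplanes `xᵢ = const`, as an equivalence relation. -/
def hyperplaneRel (i : Fin n) : Setoid (Euc n) := Setoid.comap (fun x => x i) ⊥

theorem hyperplaneRel_iff (i : Fin n) (x y : Euc n) : hyperplaneRel i x y ↔ x i = y i := Iff.rfl

theorem isPathConnected_hyperplane (i : Fin n) (x : Euc n) :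
    IsPathConnected {y | hyperplaneRel i x y} := by
  refine Convex.isPathConnected ?_ ⟨x, rfl⟩
  intro y hy z hz a b ha hb hab
  simp only [Set.mem_ofPred_eq, hyperplaneRel_iff] at hy hz ⊢
  simp [← hy, ← hz, ← add_mul, hab]

theorem joinedIn_hyperplane (i : Fin n) {U : Set (Euc n)} (hU : Convex ℝ U) {x y : Euc n}
    (hx : x ∈ U) (hy : y ∈ U) (h : x i = y i) : y ∈ leafIn (hyperplaneRel i) U x := by
  have hc : Convex ℝ ({z | hyperplaneRel i x z} ∩ U) := by
    refine Convex.inter ?_ hU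
    intro y hy z hz a b ha hb hab
    simp only [Set.mem_ofPred_eq, hyperplaneRel_iff] at hy hz ⊢
    simp [← hy, ← hz, ← add_mul, hab]
  exact (hc.isPathConnected ⟨x, rfl, hx⟩).joinedIn x ⟨rfl, hx⟩ y ⟨h, hy⟩

theorem convex_box {a b : Fin n → ℝ} : Convex ℝ {x : Euc n | ∀ k, a k < x k ∧ x k < b k} := by
  have : {x : Euc n | ∀ k, a k < x k ∧ x k < b k} =
      ⋂ k, (EuclideanSpace.proj k : Euc n →L[ℝ] ℝ) ⁻¹' Set.Ioo (a k) (b k) := by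
    ext x; simp
  rw [this]
  exact convex_iInter fun k =>
    (convex_Ioo (a k) (b k)).linear_preimage (EuclideanSpace.proj k : Euc n →L[ℝ] ℝ).toLinearMap

theorem isOpen_box {a b : Fin n → ℝ} : IsOpen {x : Euc n | ∀ k, a k < x k ∧ x k < b k} := by
  have : {x : Euc n | ∀ k, a k < x k ∧ x k < b k} =
      ⋂ k, (EuclideanSpace.proj k : Euc n →L[ℝ] ℝ) ⁻¹' Set.Ioo (a k) (b k) := by
    ext x; simp
  rw [this]
  exact isOpen_iInter_of_finite fun k => isOpen_Ioo.preimage (EuclideanSpace.proj k).continuous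

/-- The identity chart of `ℝⁿ` restricted to an open box. -/
def boxChart (a b : Fin n → ℝ) : OpenPartialHomeomorph (Euc n) (Euc n) :=
  OpenPartialHomeomorph.ofSet {x : Euc n | ∀ k, a k < x k ∧ x k < b k} isOpen_box

theorem isFoliatedChart_boxChart (a b : Fin n → ℝ) (i : Fin n) :
    IsFoliatedChart (hyperplaneRel i) (boxChart a b) i where
  mem_atlas := by
    have h := IsManifold.subset_maximalAtlas (I := 𝓘(ℝ, Euc n)) (n := ∞) (M := Euc n)
      (show OpenPartialHomeomorph.refl (Euc n) ∈ atlas (Euc n) (Euc n) by simp)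
    have h' := restr_mem_maximalAtlas (contDiffGroupoid ∞ 𝓘(ℝ, Euc n)) h
      (isOpen_box (a := a) (b := b))
    have e : (OpenPartialHomeomorph.refl (Euc n)).restr {x : Euc n | ∀ k, a k < x k ∧ x k < b k}
        = boxChart a b := by
      refine OpenPartialHomeomorph.ext _ _ (fun x => rfl) (fun x => rfl) ?_
      rw [OpenPartialHomeomorph.restr_source' _ _ isOpen_box]
      simp [boxChart]
    rw [e] at h'
    exact h'
  cubical := ⟨a, b, rfl⟩
  plaque := by
    intro x hx
    ext y
    constructor
    · intro hy
      have := hy.target_mem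
      exact ⟨this.2, Eq.symm this.1⟩
    · rintro ⟨hy, hxy⟩
      exact joinedIn_hyperplane i convex_box hx hy (Eq.symm hxy)

theorem coordDiff_eq_zero_of_hyperplane {i k : Fin n} {φ : OpenPartialHomeomorph (Euc n) (Euc n)}
    (hφ : IsFoliatedChart (hyperplaneRel i) φ k) {p : Euc n} (hp : p ∈ φ.source) (v : Euc n)
    (hv : v i = 0) : coordDiff φ k p v = 0 := by
  have hd : DifferentiableAt ℝ φ p :=
    ((contMDiffAt_of_mem_maximalAtlas hφ.mem_atlas hp).mdifferentiableAt
      (by simp)).differentiableAt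
  obtain ⟨ε, hε, hball⟩ := Metric.isOpen_iff.1 φ.open_source p hp
  have hcurve : HasDerivAt (fun t : ℝ => p + t • v) v 0 := by
    simpa using ((hasDerivAt_id (0 : ℝ)).smul_const v).const_add p
  have hlim : ∀ᶠ t : ℝ in 𝓝 0, p + t • v ∈ Metric.ball p ε := by
    refine hcurve.continuousAt.eventually ?_
    have h0 : p + (0 : ℝ) • v = p := by simp
    change Metric.ball p ε ∈ 𝓝 (p + (0 : ℝ) • v)
    rw [h0]
    exact Metric.ball_mem_nhds p hε
  have hconst : ∀ᶠ t : ℝ in 𝓝 0, φ (p + t • v) k = φ p k := by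
    filter_upwards [hlim] with t ht
    have h1 := joinedIn_hyperplane i (convex_ball p ε) (Metric.mem_ball_self hε) ht (by simp [hv])
    have h2 : p + t • v ∈ leafIn (hyperplaneRel i) φ.source p :=
      JoinedIn.mono h1 (Set.inter_subset_inter_right _ hball)
    rw [hφ.plaque p hp] at h2
    exact h2.2
  have h3 : HasDerivAt (fun t : ℝ => (EuclideanSpace.proj k : Euc n →L[ℝ] ℝ) (φ (p + t • v)))
      ((EuclideanSpace.proj k : Euc n →L[ℝ] ℝ) (fderiv ℝ φ p v)) 0 := by
    have hd' : HasFDerivAt φ (fderiv ℝ φ p) (p + (0 : ℝ) • v) := by simpa using hd.hasFDerivAt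
    exact (EuclideanSpace.proj k : Euc n →L[ℝ] ℝ).hasFDerivAt.comp_hasDerivAt 0
      (hd'.comp_hasDerivAt 0 hcurve)
  have h4 : HasDerivAt (fun t : ℝ => (EuclideanSpace.proj k : Euc n →L[ℝ] ℝ) (φ (p + t • v)))
      0 0 :=
    (hasDerivAt_const (0 : ℝ) (φ p k)).congr_of_eventuallyEq hconst
  have h5 : mfderiv 𝓘(ℝ, Euc n) 𝓘(ℝ, Euc n) φ p = fderiv ℝ φ p := mfderiv_eq_fderiv
  have h6 : coordDiff φ k p v = (EuclideanSpace.proj k : Euc n →L[ℝ] ℝ) (fderiv ℝ φ p v) := by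
    rw [← h5]; rfl
  rw [h6, h3.unique h4]

theorem leafTangent_hyperplaneRel (i : Fin n) (p : Euc n) :
    leafTangent (hyperplaneRel i) p =
      LinearMap.ker (EuclideanSpace.proj i : Euc n →L[ℝ] ℝ).toLinearMap := by
  apply le_antisymm
  · have h1 : p ∈ (boxChart (fun k => p k - 1) (fun k => p k + 1)).source :=
      fun k => ⟨by simp, by simp⟩
    refine (iInf_le_of_le (boxChart (fun k => p k - 1) (fun k => p k + 1)) <| iInf_le_of_le i <|
      iInf_le_of_le (isFoliatedChart_boxChart _ _ i) <| iInf_le_of_le h1 le_rfl).trans ?_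
    have h2 : coordDiff (boxChart (fun k => p k - 1) (fun k => p k + 1)) i p =
        (EuclideanSpace.proj i : Euc n →L[ℝ] ℝ) := by
      have : mfderiv 𝓘(ℝ, Euc n) 𝓘(ℝ, Euc n) (boxChart (fun k => p k - 1) (fun k => p k + 1)) p
          = ContinuousLinearMap.id ℝ (Euc n) := mfderiv_id
      ext v
      simp [coordDiff, this]
      rfl
    rw [h2]
    exact le_rfl
  · refine le_iInf fun φ => le_iInf fun k => le_iInf fun hφ => le_iInf fun hp => ?_
    intro v hv
    exact coordDiff_eq_zero_of_hyperplane hφ hp v hv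

/-- The foliation of `ℝⁿ` by the hyperplanes `xᵢ = const`. -/
def hyperplaneFoliation (i : Fin n) : Foliation n (Euc n) where
  leafRel := hyperplaneRel i
  leaf_pathConnected := isPathConnected_hyperplane i
  exists_chart p := ⟨boxChart (fun k => p k - 1) (fun k => p k + 1), i,
    fun k => ⟨by simp, by simp⟩, isFoliatedChart_boxChart _ _ i⟩

variable (n) in
/-- The Lebesgue volume form `dx₁ ∧ ⋯ ∧ dxₙ` on `ℝⁿ`. -/
def lebesgueForm : (Euc n) [⋀^Fin n]→ₗ[ℝ] ℝ := (EuclideanSpace.basisFun (Fin n) ℝ).toBasis.det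

theorem lebesgueForm_smooth (U : Set (Euc n)) (X : Fin n → (p : Euc n) → Tan n p)
    (_ : IsOpen U)
    (hX : ∀ k, ContMDiffOn 𝓘(ℝ, Euc n) 𝓘(ℝ, Euc n).tangent ∞
      (fun p => (⟨p, X k p⟩ : TangentBundle 𝓘(ℝ, Euc n) (Euc n))) U) :
    ContMDiffOn 𝓘(ℝ, Euc n) 𝓘(ℝ, ℝ) ∞ (fun p => lebesgueForm n (fun k => X k p)) U := by
  have h : ∀ k, ContDiffOn ℝ ∞ (fun p => (X k p : Euc n)) U :=
    fun k => contMDiffOn_vectorSpace_iff_contDiffOn.1 (hX k)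
  rw [contMDiffOn_iff_contDiffOn]
  have h' : ∀ j k, ContDiffOn ℝ ∞
      (fun p => (EuclideanSpace.proj j : Euc n →L[ℝ] ℝ) (X k p : Euc n)) U :=
    fun j k => (EuclideanSpace.proj j : Euc n →L[ℝ] ℝ).contDiff.comp_contDiffOn (h k)
  have e : (fun p => lebesgueForm n (fun k => X k p)) = fun p =>
      ∑ σ : Equiv.Perm (Fin n), (Equiv.Perm.sign σ : ℤ) •
        ∏ k, (EuclideanSpace.proj (σ k) : Euc n →L[ℝ] ℝ) (X k p : Euc n) := by
    funext p
    exact (Matrix.det_apply _)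
  rw [e]
  exact ContDiffOn.sum fun σ _ => (contDiffOn_prod fun k _ => h' (σ k) k).const_smul _

theorem finrank_quotient_ker_proj (i : Fin n) :
    Module.finrank ℝ (Euc n ⧸ LinearMap.ker (EuclideanSpace.proj i : Euc n →L[ℝ] ℝ).toLinearMap)
      = 1 := by
  have hs : Function.Surjective (EuclideanSpace.proj i : Euc n →L[ℝ] ℝ).toLinearMap := fun c =>
    ⟨EuclideanSpace.single i c, by simp⟩
  rw [(LinearMap.quotKerEquivOfSurjective _ hs).finrank_eq, Module.finrank_self]

variable (n) in
/-- The standard divergence-free `n`-web of codimension one on `ℝⁿ`: the foliations by the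
coordinate hyperplanes, with the Lebesgue volume form. -/
def standardWeb : DivFreeWeb n (Euc n) where
  fol := hyperplaneFoliation
  general_position p := by
    have h1 : ∀ i, (hyperplaneFoliation i).tangent p =
        LinearMap.ker (EuclideanSpace.proj i : Euc n →L[ℝ] ℝ).toLinearMap :=
      fun i => leafTangent_hyperplaneRel i p
    have h2 : ∀ i, Module.finrank ℝ (Tan n p ⧸ (hyperplaneFoliation i).tangent p) = 1 := by
      intro i
      rw [h1]
      exact finrank_quotient_ker_proj i
    have h3 : (⨅ i, (hyperplaneFoliation i).tangent p) = ⊥ := by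
      rw [eq_bot_iff]
      intro v hv
      have hv' : ∀ i, (EuclideanSpace.proj i : Euc n →L[ℝ] ℝ) v = 0 := by
        intro i
        have := (Submodule.mem_iInf _).1 hv i
        rw [h1] at this
        exact this
      have : (v : Euc n) = 0 := PiLp.ext hv'
      exact this
    rw [h3, (Submodule.quotEquivOfEqBot (⊥ : Submodule ℝ (Tan n p)) rfl).finrank_eq]
    simp only [h2]
    rw [Finset.sum_const, Finset.card_univ, Fintype.card_fin, smul_eq_mul, mul_one]
    exact finrank_euclideanSpace_fin (𝕜 := ℝ) (n := n)
  vol _ := lebesgueForm n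
  vol_smooth := lebesgueForm_smooth
  vol_ne_zero _ := (EuclideanSpace.basisFun (Fin n) ℝ).toBasis.det_ne_zero

end StandardWeb

section Equivalence

variable {n : ℕ} {M : Type*} [TopologicalSpace M] [ChartedSpace (Euc n) M]
  [IsManifold 𝓘(ℝ, Euc n) ∞ M]
  {N : Type*} [TopologicalSpace N] [ChartedSpace (Euc n) N]
  [IsManifold 𝓘(ℝ, Euc n) ∞ N]

/-- A local equivalence of divergence-free webs taking `p` to `q`: a diffeomorphism `Φ` of an open
neighbourhood of `p` onto an open neighbourhood of `q` which carries the leaves of each foliation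
`Fⱼ` (restricted to the domain) onto the leaves of `G_{σ(j)}` (restricted to the range) for some
permutation `σ`, and satisfies `Φ^* Ω_N = Ω_M`. -/
def DivFreeWeb.LocallyEquivalentAt (W : DivFreeWeb n M) (p : M) (W' : DivFreeWeb n N) (q : N) :
    Prop :=
  ∃ Φ : OpenPartialHomeomorph M N, p ∈ Φ.source ∧ Φ p = q ∧
    ContMDiffOn 𝓘(ℝ, Euc n) 𝓘(ℝ, Euc n) ∞ Φ Φ.source ∧
    ContMDiffOn 𝓘(ℝ, Euc n) 𝓘(ℝ, Euc n) ∞ Φ.symm Φ.target ∧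
    (∃ σ : Equiv.Perm (Fin n), ∀ j, ∀ x ∈ Φ.source,
      Φ '' leafIn (W.fol j).leafRel Φ.source x =
        leafIn (W'.fol (σ j)).leafRel Φ.target (Φ x)) ∧
    ∀ x ∈ Φ.source, ∀ v : Fin n → Tan n x,
      W'.vol (Φ x) (fun k => mfderiv 𝓘(ℝ, Euc n) 𝓘(ℝ, Euc n) Φ x (v k)) = W.vol x v

/-- A divergence-free web is locally trivial if near each point it is locally equivalent to the
standard divergence-free web. -/
def DivFreeWeb.IsLocallyTrivial (W : DivFreeWeb n M) : Prop :=
  ∀ p : M, W.LocallyEquivalentAt p (standardWeb n) 0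

end Equivalence

section Nonuniformity

variable {n : ℕ} {M : Type*} [TopologicalSpace M] [ChartedSpace (Euc n) M]
  [IsManifold 𝓘(ℝ, Euc n) ∞ M]

/-- Web-adapted coordinates: a smooth cubical chart in which, for each `i`, the plaques of the
`i`-th foliation are the slices `xᵢ = const`. -/
def DivFreeWeb.IsAdaptedChart (W : DivFreeWeb n M) (φ : OpenPartialHomeomorph M (Euc n)) : Prop :=
  ∀ i, IsFoliatedChart (W.fol i).leafRel φ i

/-- The coefficient `h` of the volume form in the coordinates `φ`, where
`Ω = h(x) dx₁ ∧ ⋯ ∧ dxₙ`, as a function of the coordinates. -/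
def DivFreeWeb.density (W : DivFreeWeb n M) (φ : OpenPartialHomeomorph M (Euc n)) (x : Euc n) :
    ℝ :=
  W.vol (φ.symm x)
    (fun k => mfderiv 𝓘(ℝ, Euc n) 𝓘(ℝ, Euc n) φ.symm x (stdVec k : Euc n))

/-- The second partial derivative `∂²f/∂xₖ∂xₗ`. -/
def secondPartial (f : Euc n → ℝ) (k l : Fin n) (x : Euc n) : ℝ :=
  fderiv ℝ (fun y => fderiv ℝ f y (stdVec l)) x (stdVec k)

/-- The value on `v, w ∈ T_p M` of `∑_{k ≠ l} (∂² log |h| / ∂xₖ ∂xₗ) dxₖ dxₗ` in the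
coordinates `φ`. -/
def DivFreeWeb.nonuniformityIn (W : DivFreeWeb n M) (φ : OpenPartialHomeomorph M (Euc n)) (p : M)
    (v w : Tan n p) : ℝ :=
  ∑ k, ∑ l, if k = l then 0 else
    secondPartial (fun x => Real.log |W.density φ x|) k l (φ p) *
      coordDiff φ k p v * coordDiff φ l p w

open Classical in
/-- The nonuniformity tensor, computed in some adapted coordinates around `p`. -/
def DivFreeWeb.nonuniformity (W : DivFreeWeb n M) (p : M) (v w : Tan n p) : ℝ :=
  if hp : ∃ φ : OpenPartialHomeomorph M (Euc n), p ∈ φ.source ∧ W.IsAdaptedChart φ then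
    W.nonuniformityIn hp.choose p v w
  else 0

end Nonuniformity

section Connections

variable {n : ℕ} {M : Type*} [TopologicalSpace M] [ChartedSpace (Euc n) M]
  [IsManifold 𝓘(ℝ, Euc n) ∞ M]

/-- `ξ¹, …, ξⁿ` is a web-adapted coframe on the open set `U`, with (smooth) dual frame
`e₁, …, eₙ`: `T Fᵢ = ker ξⁱ` and `Ω = ξ¹ ∧ ⋯ ∧ ξⁿ` on `U`. -/
structure DivFreeWeb.IsAdaptedCoframe (W : DivFreeWeb n M) (U : Set M)
    (ξ : Fin n → (p : M) → Tan n p →L[ℝ] ℝ) (e : Fin n → (p : M) → Tan n p) : Prop where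
  isOpen : IsOpen U
  smooth : ∀ k, ContMDiffOn 𝓘(ℝ, Euc n) 𝓘(ℝ, Euc n).tangent ∞
    (fun p => (⟨p, e k p⟩ : TangentBundle 𝓘(ℝ, Euc n) M)) U
  dual : ∀ p ∈ U, ∀ j k, ξ j p (e k p) = if j = k then 1 else 0
  tangent_eq : ∀ p ∈ U, ∀ i, (W.fol i).tangent p = LinearMap.ker (ξ i p).toLinearMap
  vol_eq : ∀ p ∈ U, ∀ v : Fin n → Tan n p, W.vol p v = Matrix.det (fun j k => ξ j p (v k))

variable (n M) in
/-- Affine connections (covariant derivatives of vector fields) on `M`. -/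
abbrev AffineConnection : Type _ :=
  CovariantDerivative 𝓘(ℝ, Euc n) (Euc n) (TangentSpace 𝓘(ℝ, Euc n) : M → Type)

/-- `D` is a connection adapted to the web: a smooth torsionless affine connection whose connection
forms `θʲₖ(v) = ξʲ(D_v eₖ)` with respect to every adapted coframe satisfy
`θʲₖ = 0` for `j ≠ k` (the foliations are parallel) and `∑ₖ θᵏₖ = 0` (the volume form is
parallel). -/
structure DivFreeWeb.IsWebConnection (W : DivFreeWeb n M) (D : AffineConnection n M) : Prop where
  smooth : CovariantDerivative.ContMDiffCovariantDerivative D ∞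
  torsionless : D.torsion = 0
  parallel_fol : ∀ U ξ e, W.IsAdaptedCoframe U ξ e → ∀ p ∈ U, ∀ v : Tan n p, ∀ j k, j ≠ k →
    ξ j p (D (e k) p v) = 0
  parallel_vol : ∀ U ξ e, W.IsAdaptedCoframe U ξ e → ∀ p ∈ U, ∀ v : Tan n p,
    ∑ k, ξ k p (D (e k) p v) = 0

/-- `R(X, Y)Z = D_X D_Y Z - D_Y D_X Z - D_{[X, Y]} Z` for vector fields. -/
def curvatureField (D : AffineConnection n M) (X Y Z : (p : M) → Tan n p) (p : M) : Tan n p :=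
  D (fun q => D Z q (Y q)) p (X p) - D (fun q => D Z q (X q)) p (Y p) -
    D Z p (VectorField.mlieBracket 𝓘(ℝ, Euc n) X Y p)

/-- The curvature tensor `R(u, v)w` at `p`, computed by extending `u, v, w ∈ T_p M` to vector
fields smooth near `p`. -/
def curvature (D : AffineConnection n M) (p : M) (u v w : Tan n p) : Tan n p :=
  curvatureField D (FiberBundle.extend (Euc n) u) (FiberBundle.extend (Euc n) v)
    (FiberBundle.extend (Euc n) w) p

/-- The Ricci tensor `Rc(u, w) = tr (v ↦ R(u, v)w)`, the contraction `Rcᵢₖ = ∑ⱼ Rᵢⱼₖʲ` of the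
second lower index with the upper one; the trace is computed in the basis `stdVec j` of
`T_p M = ℝⁿ`. -/
def ricci (D : AffineConnection n M) (p : M) (u w : Tan n p) : ℝ :=
  ∑ j, (EuclideanSpace.proj j : Euc n →L[ℝ] ℝ) (curvature D p u (stdVec j : Euc n) w)

/-- The connection is flat. -/
def IsFlat (D : AffineConnection n M) : Prop := ∀ p u v w, curvature D p u v w = 0

/-- The connection is Ricci-flat. -/
def IsRicciFlat (D : AffineConnection n M) : Prop := ∀ p u w, ricci D p u w = 0

end Connections

end

/-! In adapted coordinates with Ω = h dx₁ ∧ ⋯ ∧ dxₙ, everything is governed by the functions γₖ = ∂ₖ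
log |h|. Adapted coordinates exist because general position makes the n transverse coordinates of
the foliations a local diffeomorphism (`DivFreeWeb.exists_adaptedChart`).

An adapted frame has the form eₖ = cₖ ∂ₖ with h ∏ cₖ = 1. The connection whose only Christoffel
symbols are Γᵏₖₖ = γₖ is torsionless and preserves each coordinate direction, and the trace of its
connection forms is the logarithmic differential of h ∏ cₖ, hence zero
(`DivFreeWeb.IsAdaptedChart.isLocalWebConnection`). The difference of two web connections is a
symmetric tensor, diagonal and of trace zero in an adapted frame. Symmetry and diagonality leave
only the components Aᵏₖₖ, and the trace condition kills these
(`DivFreeWeb.IsLocalWebConnection.eq`). Uniqueness makes the local connections agree on overlaps, so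
they define a global one.

For this connection the components do not interact: (R(a,b)c)ₖ = cₖ (dγₖ(a) bₖ - dγₖ(b) aₖ)
(`coordConn_curvature`). Tracing over b cancels ∂ₖγₖ and leaves exactly the mixed partials of log
|h|, so Rc = K (`DivFreeWeb.IsWebConnection.ricci_eq`). Since Rc mentions no chart, K is independent
of the coordinates.

If Rc = 0, then γₖ depends on xₖ alone and R = 0. Moreover log |h| is then a sum of functions of one
variable, so h = ∏ ρₖ(xₖ), and primitives of the ρₖ are new adapted coordinates in which Ω is the
Lebesgue form. Conversely, a local trivialisation is, up to permuting coordinates, an adapted chart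
with |h| = 1, so Rc = 0. -/

noncomputable section

/-! ### Vector fields and Lie brackets read in a chart. -/

section ChartCalculus

theorem two_le_infty : (2 : ℕ∞ω) ≤ ∞ := WithTop.coe_le_coe.2 (le_top (a := (2 : ℕ∞)))

variable {n : ℕ} {M : Type*} [TopologicalSpace M] [ChartedSpace (Euc n) M]

/-- The differential of a chart, with values in the model space. -/
def chartDeriv (φ : OpenPartialHomeomorph M (Euc n)) (p : M) : Tan n p →L[ℝ] Euc n :=
  mfderiv 𝓘(ℝ, Euc n) 𝓘(ℝ, Euc n) φ p

/-- The inverse of the differential of a chart. -/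
def chartInv (φ : OpenPartialHomeomorph M (Euc n)) (p : M) : Euc n →L[ℝ] Tan n p :=
  (chartDeriv φ p).inverse

/-- The local representative of a vector field in a chart. -/
def chartRep (φ : OpenPartialHomeomorph M (Euc n)) (X : (p : M) → Tan n p) (x : Euc n) : Euc n :=
  chartDeriv φ (φ.symm x) (X (φ.symm x))

/-- The vector field with a given local representative in a chart. -/
def chartLift (φ : OpenPartialHomeomorph M (Euc n)) (V : Euc n → Euc n) (p : M) : Tan n p :=
  chartInv φ p (V (φ p))

theorem coordDiff_apply (φ : OpenPartialHomeomorph M (Euc n)) (k : Fin n) (p : M) (v : Tan n p) :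
    coordDiff φ k p v = chartDeriv φ p v k := rfl

variable {φ : OpenPartialHomeomorph M (Euc n)}

theorem mdifferentiable_of_mem_maximalAtlas (hφ : φ ∈ IsManifold.maximalAtlas 𝓘(ℝ, Euc n) ∞ M) :
    φ.MDifferentiable 𝓘(ℝ, Euc n) 𝓘(ℝ, Euc n) :=
  ⟨(contMDiffOn_of_mem_maximalAtlas hφ).mdifferentiableOn (by simp),
    (contMDiffOn_symm_of_mem_maximalAtlas hφ).mdifferentiableOn (by simp)⟩

theorem isInvertible_chartDeriv (hφ : φ ∈ IsManifold.maximalAtlas 𝓘(ℝ, Euc n) ∞ M) {p : M}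
    (hp : p ∈ φ.source) : (chartDeriv φ p).IsInvertible :=
  ⟨(mdifferentiable_of_mem_maximalAtlas hφ).mfderiv hp, rfl⟩

theorem chartInv_chartDeriv (hφ : φ ∈ IsManifold.maximalAtlas 𝓘(ℝ, Euc n) ∞ M) {p : M}
    (hp : p ∈ φ.source) (v : Tan n p) : chartInv φ p (chartDeriv φ p v) = v := by
  obtain ⟨e, he⟩ := isInvertible_chartDeriv hφ hp
  rw [chartInv, ← he, ContinuousLinearMap.inverse_equiv]
  exact e.symm_apply_apply v

theorem chartDeriv_chartInv (hφ : φ ∈ IsManifold.maximalAtlas 𝓘(ℝ, Euc n) ∞ M) {p : M}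
    (hp : p ∈ φ.source) (v : Euc n) : chartDeriv φ p (chartInv φ p v) = v := by
  obtain ⟨e, he⟩ := isInvertible_chartDeriv hφ hp
  rw [chartInv, ← he, ContinuousLinearMap.inverse_equiv]
  exact e.apply_symm_apply v

theorem chartInv_eq_mfderiv_symm (hφ : φ ∈ IsManifold.maximalAtlas 𝓘(ℝ, Euc n) ∞ M) {p : M}
    (hp : p ∈ φ.source) (v : Euc n) :
    chartInv φ p v = (mfderiv 𝓘(ℝ, Euc n) 𝓘(ℝ, Euc n) φ.symm (φ p) v : Euc n) := by
  exact congrArg (fun L : Euc n →L[ℝ] Tan n p => L v)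
    (ContinuousLinearMap.inverse_equiv ((mdifferentiable_of_mem_maximalAtlas hφ).mfderiv hp))

theorem chartRep_apply (X : (p : M) → Tan n p) {p : M} (hp : p ∈ φ.source) :
    chartRep φ X (φ p) = chartDeriv φ p (X p) := by
  have h : ∀ q, q = p → chartDeriv φ q (X q) = chartDeriv φ p (X p) := by
    rintro q rfl; rfl
  exact h _ (φ.left_inv hp)

/-- The differential of `φ` inverts that of `φ.symm`. Through this identification, the regularity of
pullbacks and their compatibility with brackets pass to `chartRep`. -/
theorem mpullback_symm_eq_chartRep (hφ : φ ∈ IsManifold.maximalAtlas 𝓘(ℝ, Euc n) ∞ M)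
    (X : (p : M) → Tan n p) {x : Euc n} (hx : x ∈ φ.target) :
    VectorField.mpullback 𝓘(ℝ, Euc n) 𝓘(ℝ, Euc n) φ.symm X x = chartRep φ X x := by
  have hp := φ.map_target hx
  have h : mfderiv 𝓘(ℝ, Euc n) 𝓘(ℝ, Euc n) φ.symm x =
      ((mdifferentiable_of_mem_maximalAtlas hφ).symm.mfderiv (x := x) hx :
        TangentSpace 𝓘(ℝ, Euc n) x →L[ℝ] Tan n (φ.symm x)) := rfl
  rw [VectorField.mpullback_apply, h, ContinuousLinearMap.inverse_equiv]
  rfl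

theorem isInvertible_mfderiv_symm (hφ : φ ∈ IsManifold.maximalAtlas 𝓘(ℝ, Euc n) ∞ M)
    {x : Euc n} (hx : x ∈ φ.target) :
    (mfderiv 𝓘(ℝ, Euc n) 𝓘(ℝ, Euc n) φ.symm x).IsInvertible :=
  ⟨(mdifferentiable_of_mem_maximalAtlas hφ).symm.mfderiv (x := x) hx, rfl⟩

variable [IsManifold 𝓘(ℝ, Euc n) ∞ M]

theorem differentiableAt_chartRep (hφ : φ ∈ IsManifold.maximalAtlas 𝓘(ℝ, Euc n) ∞ M)
    {X : (p : M) → Tan n p} {p : M} (hp : p ∈ φ.source)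
    (hX : MDifferentiableAt 𝓘(ℝ, Euc n) 𝓘(ℝ, Euc n).tangent
      (fun q => (⟨q, X q⟩ : TangentBundle 𝓘(ℝ, Euc n) M)) p) :
    DifferentiableAt ℝ (chartRep φ X) (φ p) := by
  have hx := φ.map_source hp
  have : IsManifold 𝓘(ℝ, Euc n) 2 M := .of_le (n := ∞) (by simpa using two_le_infty)
  have h := MDifferentiableAt.mpullback_vectorField (n := ∞) (f := φ.symm) (x₀ := φ p) (V := X)
    (by rwa [φ.left_inv hp]) (contMDiffAt_symm_of_mem_maximalAtlas hφ hx)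
    (isInvertible_mfderiv_symm hφ hx) two_le_infty
  have h2 : DifferentiableAt ℝ (VectorField.mpullback 𝓘(ℝ, Euc n) 𝓘(ℝ, Euc n) φ.symm X) (φ p) :=
    
    ((contMDiff_snd_tangentBundle_modelSpace (Euc n) 𝓘(ℝ, Euc n)).contMDiffAt.mdifferentiableAt
      one_ne_zero |>.comp _ h).differentiableAt
  refine h2.congr_of_eventuallyEq ?_
  filter_upwards [φ.open_target.mem_nhds hx] with y hy
  exact (mpullback_symm_eq_chartRep hφ X hy).symm

theorem contDiffAt_chartRep (hφ : φ ∈ IsManifold.maximalAtlas 𝓘(ℝ, Euc n) ∞ M)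
    {X : (p : M) → Tan n p} {p : M} (hp : p ∈ φ.source)
    (hX : ContMDiffAt 𝓘(ℝ, Euc n) 𝓘(ℝ, Euc n).tangent ∞
      (fun q => (⟨q, X q⟩ : TangentBundle 𝓘(ℝ, Euc n) M)) p) :
    ContDiffAt ℝ ∞ (chartRep φ X) (φ p) := by
  have hx := φ.map_source hp
  have h := ContMDiffAt.mpullback_vectorField_preimage (n := ∞) (m := ∞) (f := φ.symm) (x₀ := φ p)
    (V := X)
    (by rwa [φ.left_inv hp]) (contMDiffAt_symm_of_mem_maximalAtlas hφ hx)
    (isInvertible_mfderiv_symm hφ hx) (by simp)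
  have h2 : ContDiffAt ℝ ∞ (VectorField.mpullback 𝓘(ℝ, Euc n) 𝓘(ℝ, Euc n) φ.symm X) (φ p) :=
    contMDiffAt_vectorSpace_iff_contDiffAt.1 h
  refine h2.congr_of_eventuallyEq ?_
  filter_upwards [φ.open_target.mem_nhds hx] with y hy
  exact (mpullback_symm_eq_chartRep hφ X hy).symm

theorem contMDiffAt_chartLift (hφ : φ ∈ IsManifold.maximalAtlas 𝓘(ℝ, Euc n) ∞ M)
    {V : Euc n → Euc n} {p : M} (hp : p ∈ φ.source) (hV : ContDiffAt ℝ ∞ V (φ p)) :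
    ContMDiffAt 𝓘(ℝ, Euc n) 𝓘(ℝ, Euc n).tangent ∞
      (fun q => (⟨q, chartLift φ V q⟩ : TangentBundle 𝓘(ℝ, Euc n) M)) p := by
  exact ContMDiffAt.mpullback_vectorField_preimage (n := ∞) (m := ∞) (f := φ) (x₀ := p)
    (V := V) (contMDiffAt_vectorSpace_iff_contDiffAt.2 hV)
    (contMDiffAt_of_mem_maximalAtlas hφ hp) (isInvertible_chartDeriv hφ hp) (by simp)

/-- Brackets commute with pullback along `φ.symm`, and on the model space the manifold bracket is
the usual one. -/
theorem chartRep_mlieBracket (hφ : φ ∈ IsManifold.maximalAtlas 𝓘(ℝ, Euc n) ∞ M)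
    {X Y : (p : M) → Tan n p} {p : M} (hp : p ∈ φ.source)
    (hX : MDifferentiableAt 𝓘(ℝ, Euc n) 𝓘(ℝ, Euc n).tangent
      (fun q => (⟨q, X q⟩ : TangentBundle 𝓘(ℝ, Euc n) M)) p)
    (hY : MDifferentiableAt 𝓘(ℝ, Euc n) 𝓘(ℝ, Euc n).tangent
      (fun q => (⟨q, Y q⟩ : TangentBundle 𝓘(ℝ, Euc n) M)) p) :
    chartDeriv φ p (VectorField.mlieBracket 𝓘(ℝ, Euc n) X Y p) =
      fderiv ℝ (chartRep φ Y) (φ p) (chartRep φ X (φ p)) -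
        fderiv ℝ (chartRep φ X) (φ p) (chartRep φ Y (φ p)) := by
  have hx := φ.map_source hp
  have hm : IsManifold 𝓘(ℝ, Euc n) (minSmoothness ℝ 3) M :=
    .of_le (n := ∞) (by simpa using WithTop.coe_le_coe.2 (le_top (a := (3 : ℕ∞))))
  have h := VectorField.mpullback_mlieBracket (𝕜 := ℝ) (n := ∞) (f := φ.symm) (x₀ := φ p)
    (I := 𝓘(ℝ, Euc n)) (I' := 𝓘(ℝ, Euc n))
    (V := X) (W := Y)
    (by rwa [φ.left_inv hp]) (by rwa [φ.left_inv hp]) (contMDiffAt_symm_of_mem_maximalAtlas hφ hx)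
    (by simpa using two_le_infty)
  rw [mpullback_symm_eq_chartRep hφ _ hx, chartRep_apply _ hp] at h
  rw [h]
  have e : ∀ Z : (p : M) → Tan n p,
      VectorField.mpullback 𝓘(ℝ, Euc n) 𝓘(ℝ, Euc n) φ.symm Z =ᶠ[𝓝 (φ p)] chartRep φ Z := by
    intro Z
    filter_upwards [φ.open_target.mem_nhds hx] with y hy
    exact mpullback_symm_eq_chartRep hφ Z hy
  refine (Filter.EventuallyEq.mlieBracket_vectorField_eq (e X) (e Y)).trans ?_
  refine (congrFun (VectorField.mlieBracketWithin_eq_lieBracketWithin (𝕜 := ℝ)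
    (V := chartRep φ X) (W := chartRep φ Y) (s := Set.univ)) (φ p)).trans ?_
  rw [VectorField.lieBracketWithin_univ]
  rfl

end ChartCalculus

/-! ### Plaques of foliated charts and tangent spaces of leaves. -/

section Plaques

variable {n : ℕ} {M : Type*} [TopologicalSpace M] [ChartedSpace (Euc n) M]
  {r : Setoid M} {φ : OpenPartialHomeomorph M (Euc n)} {i : Fin n}

theorem rel_of_mem_leafIn {U : Set M} {x y : M} (h : y ∈ leafIn r U x) : r x y :=
  (JoinedIn.target_mem h).1

theorem mem_of_mem_leafIn {U : Set M} {x y : M} (h : y ∈ leafIn r U x) : y ∈ U :=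
  (JoinedIn.target_mem h).2

theorem leafIn_mono {U V : Set M} (h : U ⊆ V) (x : M) : leafIn r U x ⊆ leafIn r V x :=
  fun _ hy => JoinedIn.mono hy (Set.inter_subset_inter_right _ h)

/-- A path-connected set on which the transverse coordinate of a foliated chart is constant lies
on one leaf. -/
theorem IsFoliatedChart.mem_leafIn_of_isPathConnected (hφ : IsFoliatedChart r φ i) {U C : Set M}
    (hC : IsPathConnected C) (hCφ : C ⊆ φ.source) (hCU : C ⊆ U)
    (hconst : ∀ x ∈ C, ∀ y ∈ C, φ x i = φ y i) {x y : M} (hx : x ∈ C) (hy : y ∈ C) :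
    y ∈ leafIn r U x := by
  refine (hC.joinedIn x hx y hy).mono fun z hz => ⟨?_, hCU hz⟩
  have : z ∈ leafIn r φ.source x := by
    rw [hφ.plaque x (hCφ hx)]
    exact ⟨hCφ hz, hconst z hz x hx⟩
  exact rel_of_mem_leafIn this

omit [ChartedSpace (Euc n) M] in
theorem isPathConnected_symm_image (ψ : OpenPartialHomeomorph M (Euc n)) {S : Set (Euc n)}
    (hS : Convex ℝ S) (hne : S.Nonempty) (hSψ : S ⊆ ψ.target) : IsPathConnected (ψ.symm '' S) :=
  (hS.isPathConnected hne).image' (ψ.continuousOn_symm.mono hSψ)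

theorem convex_slice {B : Set (Euc n)} (hB : Convex ℝ B) (i : Fin n) (c : ℝ) :
    Convex ℝ (B ∩ {z | z i = c}) :=
  hB.inter ((convex_singleton c).linear_preimage
    (EuclideanSpace.proj i : Euc n →L[ℝ] ℝ).toLinearMap)

theorem IsOpenBox.convex {s : Set (Euc n)} (h : IsOpenBox s) : Convex ℝ s := by
  obtain ⟨a, b, rfl⟩ := h
  exact convex_box

/-- A cubical chart inside the domain of a foliated chart, whose `j`-th coordinate has the same
level sets as the transverse coordinate, is foliated. -/
theorem IsFoliatedChart.of_level_sets (hφ : IsFoliatedChart r φ i)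
    {ψ : OpenPartialHomeomorph M (Euc n)} (hψ : ψ ∈ IsManifold.maximalAtlas 𝓘(ℝ, Euc n) ∞ M)
    (hbox : IsOpenBox ψ.target) (hsub : ψ.source ⊆ φ.source) {j : Fin n}
    (hlevel : ∀ x ∈ ψ.source, ∀ y ∈ ψ.source, ψ x j = ψ y j ↔ φ x i = φ y i) :
    IsFoliatedChart r ψ j where
  mem_atlas := hψ
  cubical := hbox
  plaque x hx := by
    ext y
    constructor
    · intro hy
      have hyψ := mem_of_mem_leafIn hy
      have h2 := leafIn_mono hsub x hy
      rw [hφ.plaque x (hsub hx)] at h2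
      exact ⟨hyψ, (hlevel y hyψ x hx).2 h2.2⟩
    · rintro ⟨hyψ, hxy⟩
      have hSt : ψ.target ∩ {z | z j = ψ x j} ⊆ ψ.target := Set.inter_subset_left
      have hxS : ψ x ∈ ψ.target ∩ {z | z j = ψ x j} := ⟨ψ.map_source hx, rfl⟩
      have hyS : ψ y ∈ ψ.target ∩ {z | z j = ψ x j} := ⟨ψ.map_source hyψ, hxy⟩
      -- A slice of a box is convex, so its preimage in `M` is path-connected; the transverse
      -- coordinate of `φ` is constant on it, so it lies in one leaf.
      have hC := isPathConnected_symm_image ψ (convex_slice hbox.convex j (ψ x j)) ⟨_, hxS⟩ hSt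
      have hsrc : ψ.symm '' (ψ.target ∩ {z | z j = ψ x j}) ⊆ ψ.source := by
        rintro _ ⟨z, hz, rfl⟩
        exact ψ.map_target hz.1
      refine hφ.mem_leafIn_of_isPathConnected hC (hsrc.trans hsub) hsrc ?_
        ⟨ψ x, hxS, ψ.left_inv hx⟩ ⟨ψ y, hyS, ψ.left_inv hyψ⟩
      rintro _ ⟨z, hz, rfl⟩ _ ⟨w, hw, rfl⟩
      refine (hlevel _ (ψ.map_target hz.1) _ (ψ.map_target hw.1)).1 ?_
      rw [ψ.right_inv hz.1, ψ.right_inv hw.1]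
      exact hz.2.trans hw.2.symm

/-- A straight curve inside a slice of `φ` stays in one plaque of `ψ` near `p`, so the transverse
coordinate of `ψ` is constant along it and its differential kills the velocity. -/
theorem IsFoliatedChart.ker_coordDiff_le (hφ : IsFoliatedChart r φ i)
    {ψ : OpenPartialHomeomorph M (Euc n)} {j : Fin n} (hψ : IsFoliatedChart r ψ j) {p : M}
    (hp : p ∈ φ.source) (hpψ : p ∈ ψ.source) {v : Tan n p} (hv : coordDiff φ i p v = 0) :
    coordDiff ψ j p v = 0 := by
  set A : Euc n := chartDeriv φ p v with hA
  have hopen : IsOpen (φ.target ∩ φ.symm ⁻¹' ψ.source) :=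
    φ.symm.isOpen_inter_preimage ψ.open_source
  have hmem : φ p ∈ φ.target ∩ φ.symm ⁻¹' ψ.source :=
    ⟨φ.map_source hp, by simpa [φ.left_inv hp] using hpψ⟩
  obtain ⟨ε, hε, hball⟩ := Metric.isOpen_iff.1 hopen _ hmem
  set S : Set (Euc n) := Metric.ball (φ p) ε ∩ {z | z i = φ p i} with hS
  have hpS : φ p ∈ S := ⟨Metric.mem_ball_self hε, rfl⟩
  -- The domain of `ψ` may cut a slice of `φ` into several pieces, so the slice is first shrunk to a
  -- ball, where it is convex and hence connected inside `ψ.source`.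
  have hC := isPathConnected_symm_image φ (convex_slice (convex_ball (φ p) ε) i (φ p i)) ⟨_, hpS⟩
    fun z hz => (hball hz.1).1
  have hconst : ∀ z ∈ S, ψ (φ.symm z) j = ψ p j := by
    intro z hz
    have h1 : φ.symm z ∈ leafIn r ψ.source p := by
      refine hφ.mem_leafIn_of_isPathConnected hC ?_ ?_ ?_ ⟨φ p, hpS, φ.left_inv hp⟩ ⟨z, hz, rfl⟩
      · rintro _ ⟨w, hw, rfl⟩
        exact φ.map_target (hball hw.1).1
      · rintro _ ⟨w, hw, rfl⟩
        exact (hball hw.1).2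
      · rintro _ ⟨w, hw, rfl⟩ _ ⟨w', hw', rfl⟩
        rw [φ.right_inv (hball hw.1).1, φ.right_inv (hball hw'.1).1]
        exact hw.2.trans hw'.2.symm
    rw [hψ.plaque p hpψ] at h1
    exact h1.2
  have hcurve : HasDerivAt (fun t : ℝ => φ p + t • A) A 0 := by
    simpa using ((hasDerivAt_id (0 : ℝ)).smul_const A).const_add (φ p)
  have hev : ∀ᶠ t : ℝ in 𝓝 0, φ p + t • A ∈ S := by
    have h0 : ∀ᶠ t : ℝ in 𝓝 0, φ p + t • A ∈ Metric.ball (φ p) ε := by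
      refine hcurve.continuousAt.eventually (Metric.isOpen_ball.mem_nhds ?_)
      simpa using hε
    filter_upwards [h0] with t ht
    refine ⟨ht, ?_⟩
    have : A i = 0 := hv
    simp [this]
  have hdφ := mdifferentiable_of_mem_maximalAtlas hφ.mem_atlas
  have hdψ := mdifferentiable_of_mem_maximalAtlas hψ.mem_atlas
  have hg : MDifferentiableAt 𝓘(ℝ, Euc n) 𝓘(ℝ, Euc n) (ψ ∘ φ.symm) (φ p) :=
    MDifferentiableAt.comp (φ p) (by rw [φ.left_inv hp]; exact hdψ.mdifferentiableAt hpψ)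
      (hdφ.mdifferentiableAt_symm (φ.map_source hp))
  have hG : HasFDerivAt (ψ ∘ φ.symm) (fderiv ℝ (ψ ∘ φ.symm) (φ p)) (φ p + (0 : ℝ) • A) := by
    simpa using hg.differentiableAt.hasFDerivAt
  have hval : fderiv ℝ (ψ ∘ φ.symm) (φ p) A = chartDeriv ψ p v := by
    have h1 : mfderiv 𝓘(ℝ, Euc n) 𝓘(ℝ, Euc n) ((ψ ∘ φ.symm) ∘ φ) p =
        (mfderiv 𝓘(ℝ, Euc n) 𝓘(ℝ, Euc n) (ψ ∘ φ.symm) (φ p)).comp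
          (mfderiv 𝓘(ℝ, Euc n) 𝓘(ℝ, Euc n) φ p) :=
      mfderiv_comp p hg (hdφ.mdifferentiableAt hp)
    have h2 : mfderiv 𝓘(ℝ, Euc n) 𝓘(ℝ, Euc n) ((ψ ∘ φ.symm) ∘ φ) p =
        mfderiv 𝓘(ℝ, Euc n) 𝓘(ℝ, Euc n) ψ p := by
      refine Filter.EventuallyEq.mfderiv_eq ?_
      filter_upwards [φ.open_source.mem_nhds hp] with q hq
      simp [φ.left_inv hq]
    rw [mfderiv_eq_fderiv] at h1
    have h3 := congrArg (fun L => L v) (h2.symm.trans h1)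
    exact h3.symm
  have h3 : HasDerivAt (fun t : ℝ => (EuclideanSpace.proj j : Euc n →L[ℝ] ℝ)
      ((ψ ∘ φ.symm) (φ p + t • A)))
      ((EuclideanSpace.proj j : Euc n →L[ℝ] ℝ) (fderiv ℝ (ψ ∘ φ.symm) (φ p) A)) 0 :=
    (EuclideanSpace.proj j : Euc n →L[ℝ] ℝ).hasFDerivAt.comp_hasDerivAt 0
      (hG.comp_hasDerivAt 0 hcurve)
  have h4 : HasDerivAt (fun t : ℝ => (EuclideanSpace.proj j : Euc n →L[ℝ] ℝ)
      ((ψ ∘ φ.symm) (φ p + t • A))) 0 0 :=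
    (hasDerivAt_const (0 : ℝ) (ψ p j)).congr_of_eventuallyEq (hev.mono fun t ht => hconst _ ht)
  rw [hval] at h3
  exact h3.unique h4

/-- By `ker_coordDiff_le`, every foliated chart at `p` contributes the same kernel to the
intersection, so a single chart computes it. -/
theorem IsFoliatedChart.leafTangent_eq (hφ : IsFoliatedChart r φ i) {p : M} (hp : p ∈ φ.source) :
    leafTangent r p = LinearMap.ker (coordDiff φ i p).toLinearMap := by
  apply le_antisymm
  · exact iInf_le_of_le φ <| iInf_le_of_le i <| iInf_le_of_le hφ <| iInf_le_of_le hp le_rfl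
  · refine le_iInf fun ψ => le_iInf fun j => le_iInf fun hψ => le_iInf fun hpψ => ?_
    intro v hv
    exact hφ.ker_coordDiff_le hψ hp hpψ hv

theorem finrank_quotient_ker_coordDiff (hφ : φ ∈ IsManifold.maximalAtlas 𝓘(ℝ, Euc n) ∞ M) {p : M}
    (hp : p ∈ φ.source) (i : Fin n) :
    Module.finrank ℝ (Tan n p ⧸ LinearMap.ker (coordDiff φ i p).toLinearMap) = 1 := by
  have hs : Function.Surjective (coordDiff φ i p).toLinearMap := fun c =>
    ⟨chartInv φ p (EuclideanSpace.single i c), by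
      change chartDeriv φ p (chartInv φ p (EuclideanSpace.single i c)) i = c
      rw [chartDeriv_chartInv hφ hp]; simp⟩
  rw [(LinearMap.quotKerEquivOfSurjective _ hs).finrank_eq, Module.finrank_self]

end Plaques

/-! ### Construction of cubical charts and the inverse function theorem. -/

section ChartConstruction

variable {n : ℕ}

/-- Boxes are balls of the sup norm, which defines the same topology. -/
theorem exists_box_subset {s : Set (Euc n)} (hs : IsOpen s) {y : Euc n} (hy : y ∈ s) :
    ∃ ε > 0, {x : Euc n | ∀ k, y k - ε < x k ∧ x k < y k + ε} ⊆ s := by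
  obtain ⟨ε, hε, hsub⟩ := Metric.isOpen_iff.1
    (hs.preimage (EuclideanSpace.equiv (Fin n) ℝ).symm.continuous)
    (EuclideanSpace.equiv (Fin n) ℝ y) (by simpa using hy)
  refine ⟨ε, hε, fun x hx => ?_⟩
  have : EuclideanSpace.equiv (Fin n) ℝ x ∈ Metric.ball (EuclideanSpace.equiv (Fin n) ℝ y) ε := by
    rw [Metric.mem_ball, dist_pi_lt_iff hε]
    intro k
    rw [Real.dist_eq, abs_sub_lt_iff]
    have := hx k
    constructor <;> simp <;> linarith
  simpa using hsub this

variable {M : Type*} [TopologicalSpace M] [ChartedSpace (Euc n) M]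
  [IsManifold 𝓘(ℝ, Euc n) ∞ M]

/-- A partial diffeomorphism onto an open subset of `ℝⁿ` restricts to a cubical chart around every
point. -/
theorem exists_cubical_restriction (Φ₀ : OpenPartialHomeomorph M (Euc n))
    (h₁ : ContMDiffOn 𝓘(ℝ, Euc n) 𝓘(ℝ, Euc n) ∞ Φ₀ Φ₀.source)
    (h₂ : ContMDiffOn 𝓘(ℝ, Euc n) 𝓘(ℝ, Euc n) ∞ Φ₀.symm Φ₀.target) {p : M} (hp : p ∈ Φ₀.source) :
    ∃ Φ ∈ IsManifold.maximalAtlas 𝓘(ℝ, Euc n) ∞ M, p ∈ Φ.source ∧ Φ.source ⊆ Φ₀.source ∧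
      IsOpenBox Φ.target ∧ ⇑Φ = Φ₀ ∧ ⇑Φ.symm = Φ₀.symm := by
  obtain ⟨ε, hε, hbox⟩ := exists_box_subset Φ₀.open_target (Φ₀.map_source hp)
  have hBo := isOpen_box (a := fun k => Φ₀ p k - ε) (b := fun k => Φ₀ p k + ε)
  have hsrc : ∀ q, q ∈ (Φ₀.symm.restrOpen _ hBo).symm.source ↔
      q ∈ Φ₀.source ∧ Φ₀ q ∈ {x : Euc n | ∀ k, Φ₀ p k - ε < x k ∧ x k < Φ₀ p k + ε} :=
    fun q => by simp
  have htgt : (Φ₀.symm.restrOpen _ hBo).symm.target =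
      {x : Euc n | ∀ k, Φ₀ p k - ε < x k ∧ x k < Φ₀ p k + ε} := by
    simpa using hbox
  refine ⟨(Φ₀.symm.restrOpen _ hBo).symm, ?_, ?_, fun q hq => ((hsrc q).1 hq).1, ⟨_, _, htgt⟩,
    rfl, rfl⟩
  · refine OpenPartialHomeomorph.mem_maximalAtlas_of_contMDiffOn _
      (h₁.mono fun q hq => ((hsrc q).1 hq).1) (h₂.mono ?_)
    rw [htgt]
    exact hbox
  · rw [hsrc]
    exact ⟨hp, fun k => ⟨by linarith, by linarith⟩⟩

omit [IsManifold 𝓘(ℝ, Euc n) ∞ M] in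
theorem hasMFDerivAt_coord {f : M → Euc n} {q : M}
    (hf : MDifferentiableAt 𝓘(ℝ, Euc n) 𝓘(ℝ, Euc n) f q) (i : Fin n) :
    HasMFDerivAt 𝓘(ℝ, Euc n) 𝓘(ℝ, ℝ) (fun q => f q i) q
      ((EuclideanSpace.proj i : Euc n →L[ℝ] ℝ) ∘L
        (mfderiv 𝓘(ℝ, Euc n) 𝓘(ℝ, Euc n) f q : Tan n q →L[ℝ] Euc n)) :=
  (EuclideanSpace.proj i : Euc n →L[ℝ] ℝ).hasMFDerivAt.comp q hf.hasMFDerivAt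

/-- The inverse function theorem: a smooth map with invertible differentials restricts to a cubical
chart around every point. -/
theorem exists_cubical_chart {U : Set M} (hU : IsOpen U) {p : M} (hp : p ∈ U) {f : M → Euc n}
    (hf : ContMDiffOn 𝓘(ℝ, Euc n) 𝓘(ℝ, Euc n) ∞ f U)
    (hinj : ∀ q ∈ U, ∀ v : Tan n q,
      (mfderiv 𝓘(ℝ, Euc n) 𝓘(ℝ, Euc n) f q v : Euc n) = 0 → v = 0) :
    ∃ Φ ∈ IsManifold.maximalAtlas 𝓘(ℝ, Euc n) ∞ M, p ∈ Φ.source ∧ Φ.source ⊆ U ∧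
      IsOpenBox Φ.target ∧ ∀ q ∈ Φ.source, Φ q = f q := by
  set χ := chartAt (Euc n) p with hχ
  have hχm : χ ∈ IsManifold.maximalAtlas 𝓘(ℝ, Euc n) ∞ M := IsManifold.chart_mem_maximalAtlas p
  have hpχ : p ∈ χ.source := mem_chart_source _ p
  set g : Euc n → Euc n := f ∘ χ.symm with hg
  have hfat : ∀ q ∈ U, ContMDiffAt 𝓘(ℝ, Euc n) 𝓘(ℝ, Euc n) ∞ f q := fun q hq =>
    hf.contMDiffAt (hU.mem_nhds hq)
  have hsm : ∀ x ∈ χ.target, χ.symm x ∈ U → ContDiffAt ℝ ∞ g x := fun x hx hxU =>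
    ((hfat _ hxU).comp x (contMDiffAt_symm_of_mem_maximalAtlas hχm hx)).contDiffAt
  have hder : ∀ x ∈ χ.target, χ.symm x ∈ U →
      ∃ e : Euc n ≃L[ℝ] Euc n, HasFDerivAt g (e : Euc n →L[ℝ] Euc n) x := by
    intro x hx hxU
    have h1 : mfderiv 𝓘(ℝ, Euc n) 𝓘(ℝ, Euc n) (f ∘ χ.symm) x =
        (mfderiv 𝓘(ℝ, Euc n) 𝓘(ℝ, Euc n) f (χ.symm x)).comp
          (mfderiv 𝓘(ℝ, Euc n) 𝓘(ℝ, Euc n) χ.symm x) :=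
      mfderiv_comp x ((hfat _ hxU).mdifferentiableAt (by simp))
        ((mdifferentiable_of_mem_maximalAtlas hχm).mdifferentiableAt_symm hx)
    rw [mfderiv_eq_fderiv] at h1
    -- An injective endomorphism of a finite-dimensional space is invertible, so injectivity of the
    -- differential suffices.
    have hin : Function.Injective (fderiv ℝ g x) := by
      rw [injective_iff_map_eq_zero]
      intro v hv
      have h2 := hinj _ hxU (mfderiv 𝓘(ℝ, Euc n) 𝓘(ℝ, Euc n) χ.symm x v)
        ((congrArg (fun L => L v) h1).symm.trans hv)
      exact (mdifferentiable_of_mem_maximalAtlas hχm).symm.mfderiv_injective (x := x) hx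
        (h2.trans (map_zero _).symm)
    refine ⟨(LinearEquiv.ofInjectiveEndo (fderiv ℝ g x).toLinearMap hin).toContinuousLinearEquiv,
      ?_⟩
    exact ((hsm x hx hxU).differentiableAt (by simp)).hasFDerivAt
  have hp0 : χ.symm (χ p) = p := χ.left_inv hpχ
  obtain ⟨e0, he0⟩ := hder (χ p) (χ.map_source hpχ) (by rwa [hp0])
  have hg0 := hsm (χ p) (χ.map_source hpχ) (by rwa [hp0])
  set E := hg0.toOpenPartialHomeomorph g he0 (by simp) with hE
  have hEg : ∀ x, E x = g x := fun x => rfl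
  have hpE : χ p ∈ E.source := hg0.mem_toOpenPartialHomeomorph_source he0 (by simp)
  set Φ₀ := (χ.restrOpen U hU).trans E with hΦ₀
  have hsrc : ∀ q, q ∈ Φ₀.source ↔ (q ∈ χ.source ∧ q ∈ U) ∧ χ q ∈ E.source := fun q => by
    simp [hΦ₀]
  have hpΦ₀ : p ∈ Φ₀.source := (hsrc p).2 ⟨⟨hpχ, hp⟩, hpE⟩
  have hΦ₀f : ∀ q ∈ Φ₀.source, Φ₀ q = f q := fun q hq => by
    change f (χ.symm (χ q)) = f q
    rw [χ.left_inv ((hsrc q).1 hq).1.1]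
  have h₁ : ContMDiffOn 𝓘(ℝ, Euc n) 𝓘(ℝ, Euc n) ∞ Φ₀ Φ₀.source :=
    (hf.mono fun q hq => ((hsrc q).1 hq).1.2).congr hΦ₀f
  -- Smoothness of the inverse is needed on the whole target, not only at the image of `p`; at each
  -- point it uses invertibility of the derivative there, from `hder`.
  have h₂ : ContMDiffOn 𝓘(ℝ, Euc n) 𝓘(ℝ, Euc n) ∞ Φ₀.symm Φ₀.target := by
    intro y hy
    have hq := (hsrc _).1 (Φ₀.map_target hy)
    have hyE : y ∈ E.target := by
      have := E.map_source hq.2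
      rwa [show E (χ (Φ₀.symm y)) = y from Φ₀.right_inv hy] at this
    have hx : E.symm y ∈ χ.target ∧ χ.symm (E.symm y) ∈ U := by
      have : χ (Φ₀.symm y) = E.symm y := by
        rw [← E.left_inv hq.2, show E (χ (Φ₀.symm y)) = y from Φ₀.right_inv hy]
      rw [← this]
      exact ⟨χ.map_source hq.1.1, by rw [χ.left_inv hq.1.1]; exact hq.1.2⟩
    obtain ⟨e, he⟩ := hder _ hx.1 hx.2
    have h3 : ContDiffAt ℝ ∞ E.symm y := E.contDiffAt_symm hyE he (hsm _ hx.1 hx.2)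
    exact ((contMDiffAt_symm_of_mem_maximalAtlas hχm hx.1).comp y h3.contMDiffAt).contMDiffWithinAt
  obtain ⟨Φ, h1, h2, h3, h4, h5, -⟩ := exists_cubical_restriction Φ₀ h₁ h₂ hpΦ₀
  exact ⟨Φ, h1, h2, fun q hq => ((hsrc q).1 (h3 hq)).1.2, h4, fun q hq => by
    rw [h5, hΦ₀f q (h3 hq)]⟩

end ChartConstruction

/-! ### Existence of adapted coordinates. -/

section AdaptedCharts

variable {n : ℕ} {M : Type*} [TopologicalSpace M] [ChartedSpace (Euc n) M]
  [IsManifold 𝓘(ℝ, Euc n) ∞ M]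

/-- Each `T_p Fᵢ` has codimension one, so general position gives the intersection codimension `n`,
the full dimension. -/
theorem DivFreeWeb.iInf_tangent_eq_bot (W : DivFreeWeb n M) (p : M) :
    ⨅ i, (W.fol i).tangent p = ⊥ := by
  have h1 : ∀ i, Module.finrank ℝ (Tan n p ⧸ (W.fol i).tangent p) = 1 := by
    intro i
    obtain ⟨φ, k, hp, hφ⟩ := (W.fol i).exists_chart p
    rw [Foliation.tangent, hφ.leafTangent_eq hp]
    exact finrank_quotient_ker_coordDiff hφ.mem_atlas hp k
  have h2 := W.general_position p
  simp only [h1, Finset.sum_const, Finset.card_univ, Fintype.card_fin, smul_eq_mul, mul_one] at h2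
  have : FiniteDimensional ℝ (Tan n p) := inferInstanceAs (FiniteDimensional ℝ (Euc n))
  have h3 := Submodule.finrank_quotient_add_finrank (⨅ i, (W.fol i).tangent p)
  have h4 : Module.finrank ℝ (Tan n p) = n := finrank_euclideanSpace_fin (𝕜 := ℝ) (n := n)
  rw [h2, h4] at h3
  exact Submodule.finrank_eq_zero.1 (by omega)

/-- There are adapted coordinates centred at every point. -/
theorem DivFreeWeb.exists_adaptedChart (W : DivFreeWeb n M) (p : M) :
    ∃ φ : OpenPartialHomeomorph M (Euc n), p ∈ φ.source ∧ φ p = 0 ∧ W.IsAdaptedChart φ := by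
  choose φ k hp hφ using fun i => (W.fol i).exists_chart p
  set U : Set M := ⋂ i, (φ i).source with hU
  have hUo : IsOpen U := isOpen_iInter_of_finite fun i => (φ i).open_source
  have hpU : p ∈ U := Set.mem_iInter.2 hp
  have hUφ : ∀ i, U ⊆ (φ i).source := fun i => Set.iInter_subset _ i
  -- The transverse coordinates, one from each foliation, are translated so that `f p = 0`.
  set f : M → Euc n := fun q => WithLp.toLp 2 fun i => φ i q (k i) - φ i p (k i) with hf
  have hcomp : ∀ i q, f q i = φ i q (k i) - φ i p (k i) := fun i q => rfl
  have hsm : ContMDiffOn 𝓘(ℝ, Euc n) 𝓘(ℝ, Euc n) ∞ f U := by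
    have h1 : ∀ i, ContMDiffOn 𝓘(ℝ, Euc n) 𝓘(ℝ, ℝ) ∞ (fun q => φ i q (k i) - φ i p (k i)) U :=
      fun i => (((EuclideanSpace.proj (k i) : Euc n →L[ℝ] ℝ).contMDiff.comp_contMDiffOn
        (contMDiffOn_of_mem_maximalAtlas (hφ i).mem_atlas)).mono (hUφ i)).sub contMDiffOn_const
    have h2 : ContMDiffOn 𝓘(ℝ, Euc n) 𝓘(ℝ, Fin n → ℝ) ∞
        (fun q i => φ i q (k i) - φ i p (k i)) U := contMDiffOn_pi_space.2 h1
    exact ((EuclideanSpace.equiv (Fin n) ℝ).symm : (Fin n → ℝ) →L[ℝ] Euc n).contMDiff.comp_contMDiffOn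
      h2
  have hder : ∀ q ∈ U, ∀ (v : Tan n q) i,
      EuclideanSpace.proj i (mfderiv 𝓘(ℝ, Euc n) 𝓘(ℝ, Euc n) f q v : Euc n) =
        coordDiff (φ i) (k i) q v := by
    intro q hq v i
    have h1 := hasMFDerivAt_coord
      (((hsm q hq).contMDiffAt (hUo.mem_nhds hq)).mdifferentiableAt (by simp)) i
    have h2 := (hasMFDerivAt_coord ((mdifferentiable_of_mem_maximalAtlas
      (hφ i).mem_atlas).mdifferentiableAt (hUφ i hq)) (k i)).sub
        (hasMFDerivAt_const (φ i p (k i)) q)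
    have h3 := congrArg (fun L : Euc n →L[ℝ] ℝ => L v) (hasMFDerivAt_unique h1 h2)
    exact h3.trans (sub_zero _)
  -- The kernel of the differential of `f` is the intersection of the tangent spaces `T_q Fᵢ`, which
  -- is zero.
  obtain ⟨Φ, hΦ, hpΦ, hΦU, hbox, hΦf⟩ := exists_cubical_chart hUo hpU hsm fun q hq v hv => by
    have h1 : v ∈ ⨅ i, (W.fol i).tangent q := by
      rw [Submodule.mem_iInf]
      intro i
      rw [Foliation.tangent, (hφ i).leafTangent_eq (hUφ i hq)]
      change coordDiff (φ i) (k i) q v = 0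
      rw [← hder q hq v i, hv]
      rfl
    rwa [W.iInf_tangent_eq_bot q] at h1
  refine ⟨Φ, hpΦ, ?_, fun i => (hφ i).of_level_sets hΦ hbox (hΦU.trans (hUφ i)) ?_⟩
  · rw [hΦf p hpΦ]
    ext i
    simp [hcomp]
  · intro x hx y hy
    rw [hΦf x hx, hΦf y hy, hcomp, hcomp, sub_left_inj]

end AdaptedCharts

/-! ### Coordinate frames. -/

section Frames

variable {n : ℕ} {M : Type*} [TopologicalSpace M] [ChartedSpace (Euc n) M]
  {φ : OpenPartialHomeomorph M (Euc n)}

/-- The coordinate vector fields of a chart. -/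
def chartFrame (φ : OpenPartialHomeomorph M (Euc n)) (k : Fin n) (p : M) : Tan n p :=
  chartLift φ (fun _ => stdVec k) p

theorem stdVec_apply (k j : Fin n) : (stdVec k : Euc n) j = if j = k then 1 else 0 := by
  simp [stdVec]

theorem chartDeriv_chartFrame (hφ : φ ∈ IsManifold.maximalAtlas 𝓘(ℝ, Euc n) ∞ M) {p : M}
    (hp : p ∈ φ.source) (k : Fin n) : chartDeriv φ p (chartFrame φ k p) = stdVec k :=
  chartDeriv_chartInv hφ hp _

theorem coordDiff_chartFrame (hφ : φ ∈ IsManifold.maximalAtlas 𝓘(ℝ, Euc n) ∞ M) {p : M}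
    (hp : p ∈ φ.source) (j k : Fin n) :
    coordDiff φ j p (chartFrame φ k p) = if j = k then 1 else 0 := by
  rw [coordDiff_apply, chartDeriv_chartFrame hφ hp, stdVec_apply]

/-- The coordinate vector fields of a chart, as a basis of the tangent space at a point. -/
def chartBasis (hφ : φ ∈ IsManifold.maximalAtlas 𝓘(ℝ, Euc n) ∞ M) {p : M} (hp : p ∈ φ.source) :
    Module.Basis (Fin n) ℝ (Tan n p) :=
  (EuclideanSpace.basisFun (Fin n) ℝ).toBasis.map
    ((mdifferentiable_of_mem_maximalAtlas hφ).mfderiv hp).symm.toLinearEquiv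

theorem chartBasis_repr (hφ : φ ∈ IsManifold.maximalAtlas 𝓘(ℝ, Euc n) ∞ M) {p : M}
    (hp : p ∈ φ.source) (v : Tan n p) (k : Fin n) :
    (chartBasis hφ hp).repr v k = coordDiff φ k p v := rfl

theorem chartBasis_apply (hφ : φ ∈ IsManifold.maximalAtlas 𝓘(ℝ, Euc n) ∞ M) {p : M}
    (hp : p ∈ φ.source) (k : Fin n) : chartBasis hφ hp k = chartFrame φ k p := by
  apply (chartBasis hφ hp).repr.injective
  ext j
  rw [chartBasis_repr, chartBasis_repr, coordDiff_chartFrame hφ hp, ← chartBasis_repr hφ hp,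
    Module.Basis.repr_self, Finsupp.single_apply]
  simp [eq_comm]

variable [IsManifold 𝓘(ℝ, Euc n) ∞ M]

theorem contMDiffOn_chartFrame (hφ : φ ∈ IsManifold.maximalAtlas 𝓘(ℝ, Euc n) ∞ M) (k : Fin n) :
    ContMDiffOn 𝓘(ℝ, Euc n) 𝓘(ℝ, Euc n).tangent ∞
      (fun p => (⟨p, chartFrame φ k p⟩ : TangentBundle 𝓘(ℝ, Euc n) M)) φ.source :=
  fun _ hp => (contMDiffAt_chartLift hφ hp contDiffAt_const).contMDiffWithinAt

end Frames

/-! ### The coefficient of the volume form. -/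

section Density

variable {n : ℕ} {M : Type*} [TopologicalSpace M] [ChartedSpace (Euc n) M]
  [IsManifold 𝓘(ℝ, Euc n) ∞ M] (W : DivFreeWeb n M) {φ : OpenPartialHomeomorph M (Euc n)}

theorem DivFreeWeb.density_apply (hφ : φ ∈ IsManifold.maximalAtlas 𝓘(ℝ, Euc n) ∞ M) {p : M}
    (hp : p ∈ φ.source) : W.density φ (φ p) = W.vol p (fun k => chartFrame φ k p) := by
  -- The definition of `density` evaluates the form at `φ.symm (φ p)`; since every tangent space is
  -- the type `Euc n`, the base point can be replaced by `p` without moving the vectors.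
  have h : ∀ q : M, q = p → ∀ v : Fin n → Euc n, W.vol q v = W.vol p v := by
    rintro q rfl v; rfl
  refine (h _ (φ.left_inv hp) _).trans ?_
  exact congrArg (W.vol p) (funext fun k => (chartInv_eq_mfderiv_symm hφ hp (stdVec k)).symm)

theorem DivFreeWeb.vol_eq_density_mul_det (hφ : φ ∈ IsManifold.maximalAtlas 𝓘(ℝ, Euc n) ∞ M)
    {p : M} (hp : p ∈ φ.source) (v : Fin n → Tan n p) :
    W.vol p v = W.density φ (φ p) * Matrix.det (fun j k => coordDiff φ j p (v k)) := by
  have h := AlternatingMap.eq_smul_basis_det (chartBasis hφ hp) (W.vol p)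
  have h2 : ⇑(chartBasis hφ hp) = fun k => chartFrame φ k p :=
    funext fun k => chartBasis_apply hφ hp k
  rw [W.density_apply hφ hp, ← h2]
  exact congrArg (fun f : (Tan n p) [⋀^Fin n]→ₗ[ℝ] ℝ => f v) h

theorem DivFreeWeb.density_ne_zero (hφ : φ ∈ IsManifold.maximalAtlas 𝓘(ℝ, Euc n) ∞ M)
    {x : Euc n} (hx : x ∈ φ.target) : W.density φ x ≠ 0 := by
  intro h0
  apply W.vol_ne_zero (φ.symm x)
  ext v
  rw [W.vol_eq_density_mul_det hφ (φ.map_target hx), φ.right_inv hx, h0, zero_mul]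
  rfl

theorem DivFreeWeb.contMDiffOn_density_comp (hφ : φ ∈ IsManifold.maximalAtlas 𝓘(ℝ, Euc n) ∞ M) :
    ContMDiffOn 𝓘(ℝ, Euc n) 𝓘(ℝ, ℝ) ∞ (fun p => W.density φ (φ p)) φ.source :=
  (W.vol_smooth φ.source (chartFrame φ) φ.open_source (contMDiffOn_chartFrame hφ)).congr
    fun _ hp => W.density_apply hφ hp

theorem DivFreeWeb.contDiffOn_density (hφ : φ ∈ IsManifold.maximalAtlas 𝓘(ℝ, Euc n) ∞ M) :
    ContDiffOn ℝ ∞ (W.density φ) φ.target := by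
  rw [← contMDiffOn_iff_contDiffOn]
  refine ((W.contMDiffOn_density_comp hφ).comp (contMDiffOn_symm_of_mem_maximalAtlas hφ)
    fun x hx => φ.map_target hx).congr fun x hx => ?_
  simp [φ.right_inv hx]

theorem DivFreeWeb.contDiffOn_log_density
    (hφ : φ ∈ IsManifold.maximalAtlas 𝓘(ℝ, Euc n) ∞ M) :
    ContDiffOn ℝ ∞ (fun x => Real.log |W.density φ x|) φ.target := by
  simp only [Real.log_abs]
  exact (W.contDiffOn_density hφ).log fun x hx => W.density_ne_zero hφ hx

end Density

/-! ### Adapted coframes and uniqueness of the web connection. -/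

section Uniqueness

variable {n : ℕ} {M : Type*} [TopologicalSpace M] [ChartedSpace (Euc n) M]
  [IsManifold 𝓘(ℝ, Euc n) ∞ M] {W : DivFreeWeb n M} {φ : OpenPartialHomeomorph M (Euc n)}

theorem DivFreeWeb.IsAdaptedChart.mem_atlas (hφ : W.IsAdaptedChart φ) (hn : 1 ≤ n) :
    φ ∈ IsManifold.maximalAtlas 𝓘(ℝ, Euc n) ∞ M := (hφ ⟨0, hn⟩).mem_atlas

/-- The coframe `h dx₁, dx₂, …, dxₙ` given by adapted coordinates. -/
theorem DivFreeWeb.IsAdaptedChart.exists_isAdaptedCoframe (hφ : W.IsAdaptedChart φ) (hn : 1 ≤ n) :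
    ∃ ξ e, W.IsAdaptedCoframe φ.source ξ e := by
  have hm := hφ.mem_atlas hn
  -- The whole density is put into the first covector, so that the product of the factors is `h`.
  set c : Fin n → M → ℝ := fun k p => if k = ⟨0, hn⟩ then W.density φ (φ p) else 1 with hc
  have hc0 : ∀ k, ∀ p ∈ φ.source, c k p ≠ 0 := by
    intro k p hp
    simp only [hc]
    split_ifs
    · exact W.density_ne_zero hm (φ.map_source hp)
    · exact one_ne_zero
  have hcs : ∀ k, ContMDiffOn 𝓘(ℝ, Euc n) 𝓘(ℝ, ℝ) ∞ (c k) φ.source := by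
    intro k
    simp only [hc]
    split_ifs
    · exact W.contMDiffOn_density_comp hm
    · exact contMDiffOn_const
  refine ⟨fun k p => c k p • coordDiff φ k p, fun k p => (c k p)⁻¹ • chartFrame φ k p,
    φ.open_source, fun k => ?_, fun p hp j k => ?_, fun p hp i => ?_, fun p hp v => ?_⟩
  · exact ContMDiffOn.smul_section ((hcs k).inv₀ (hc0 k)) (contMDiffOn_chartFrame hm k)
  · simp only [smul_apply, map_smul, smul_eq_mul, coordDiff_chartFrame hm hp]
    split_ifs with h
    · subst h
      rw [mul_one, inv_mul_cancel₀ (hc0 j p hp)]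
    · simp
  · rw [Foliation.tangent, (hφ i).leafTangent_eq hp]
    ext v
    simp [hc0 i p hp]
  · rw [W.vol_eq_density_mul_det hm hp]
    simp only [smul_apply, smul_eq_mul]
    have := Matrix.det_mul_column (fun j => c j p) (fun j k => coordDiff φ j p (v k))
    refine Eq.trans ?_ this.symm
    congr 1
    simp [hc]

/-- A covariant derivative over the open set `U` which is adapted to the web. -/
structure DivFreeWeb.IsLocalWebConnection (W : DivFreeWeb n M)
    (D : ((p : M) → Tan n p) → (p : M) → Tan n p →L[ℝ] Tan n p) (U : Set M) : Prop where
  isCovariantDerivativeOn : IsCovariantDerivativeOn (I := 𝓘(ℝ, Euc n)) (Euc n)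
    (V := fun p : M => Tan n p) D U
  torsionless : ∀ (X Y : (p : M) → Tan n p), ∀ p ∈ U,
    MDifferentiableAt 𝓘(ℝ, Euc n) 𝓘(ℝ, Euc n).tangent
      (fun q => (⟨q, X q⟩ : TangentBundle 𝓘(ℝ, Euc n) M)) p →
    MDifferentiableAt 𝓘(ℝ, Euc n) 𝓘(ℝ, Euc n).tangent
      (fun q => (⟨q, Y q⟩ : TangentBundle 𝓘(ℝ, Euc n) M)) p →
    D Y p (X p) - D X p (Y p) = VectorField.mlieBracket 𝓘(ℝ, Euc n) X Y p
  parallel_fol : ∀ V ξ e, W.IsAdaptedCoframe V ξ e → ∀ p ∈ U, p ∈ V → ∀ v : Tan n p,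
    ∀ j k, j ≠ k → ξ j p (D (e k) p v) = 0
  parallel_vol : ∀ V ξ e, W.IsAdaptedCoframe V ξ e → ∀ p ∈ U, p ∈ V → ∀ v : Tan n p,
    ∑ k, ξ k p (D (e k) p v) = 0

theorem DivFreeWeb.IsWebConnection.isLocalWebConnection {D : AffineConnection n M}
    (hD : W.IsWebConnection D) (U : Set M) : W.IsLocalWebConnection D U where
  isCovariantDerivativeOn := D.isCovariantDerivativeOn
  torsionless _ _ _ _ hX hY := D.torsion_eq_zero_iff.1 hD.torsionless hX hY
  parallel_fol V ξ e h p _ hp v j k hjk := hD.parallel_fol V ξ e h p hp v j k hjk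
  parallel_vol V ξ e h p _ hp v := hD.parallel_vol V ξ e h p hp v

theorem DivFreeWeb.IsAdaptedCoframe.eq_zero {V : Set M} {ξ : Fin n → (p : M) → Tan n p →L[ℝ] ℝ}
    {e : Fin n → (p : M) → Tan n p} (h : W.IsAdaptedCoframe V ξ e) {p : M} (hp : p ∈ V)
    {v : Tan n p} (hv : ∀ i, ξ i p v = 0) : v = 0 := by
  have h1 : v ∈ ⨅ i, (W.fol i).tangent p := by
    rw [Submodule.mem_iInf]
    intro i
    rw [h.tangent_eq p hp i]
    exact hv i
  rwa [W.iInf_tangent_eq_bot p] at h1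

theorem DivFreeWeb.IsAdaptedCoframe.sum_smul {V : Set M}
    {ξ : Fin n → (p : M) → Tan n p →L[ℝ] ℝ}
    {e : Fin n → (p : M) → Tan n p} (h : W.IsAdaptedCoframe V ξ e) {p : M} (hp : p ∈ V)
    (v : Tan n p) : ∑ k, ξ k p v • e k p = v := by
  rw [← sub_eq_zero]
  refine h.eq_zero hp fun i => ?_
  simp [h.dual p hp]

/-- In an adapted frame the difference tensor sends `(eₖ, eₗ)` to a multiple of `eₖ`, since the
foliations are parallel, and by symmetry also to a multiple of `eₗ`. Only `k = l` survives, and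
there the trace condition applied to `eₗ` has a single nonzero term. Differentiability of `X` at `p`
is required because the axioms of a covariant derivative say nothing about other fields. -/
theorem DivFreeWeb.IsLocalWebConnection.eq
    {D D' : ((p : M) → Tan n p) → (p : M) → Tan n p →L[ℝ] Tan n p} {U : Set M}
    (hn : 1 ≤ n) (h : W.IsLocalWebConnection D U) (h' : W.IsLocalWebConnection D' U)
    {p : M} (hp : p ∈ U) {X : (p : M) → Tan n p}
    (hX : MDifferentiableAt 𝓘(ℝ, Euc n) 𝓘(ℝ, Euc n).tangent
      (fun q => (⟨q, X q⟩ : TangentBundle 𝓘(ℝ, Euc n) M)) p) : D X p = D' X p := by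
  obtain ⟨φ, hpφ, -, hφ⟩ := W.exists_adaptedChart p
  obtain ⟨ξ, e, he⟩ := hφ.exists_isAdaptedCoframe hn
  set A := h.isCovariantDerivativeOn.difference h'.isCovariantDerivativeOn p with hA
  have hAX : ∀ Y : (p : M) → Tan n p, MDifferentiableAt 𝓘(ℝ, Euc n) 𝓘(ℝ, Euc n).tangent
      (fun q => (⟨q, Y q⟩ : TangentBundle 𝓘(ℝ, Euc n) M)) p → A (Y p) = D Y p - D' Y p :=
    fun Y hY => IsCovariantDerivativeOn.difference_apply _ _ hp hY
  have hed : ∀ k, MDifferentiableAt 𝓘(ℝ, Euc n) 𝓘(ℝ, Euc n).tangent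
      (fun q => (⟨q, e k q⟩ : TangentBundle 𝓘(ℝ, Euc n) M)) p := fun k =>
    ((he.smooth k).contMDiffAt (he.isOpen.mem_nhds hpφ)).mdifferentiableAt (by simp)
  -- Both connections have the same antisymmetrisation, namely the bracket, so it cancels in the
  -- difference.
  have hsymm : ∀ k l, A (e k p) (e l p) = A (e l p) (e k p) := by
    intro k l
    rw [hAX _ (hed k), hAX _ (hed l), sub_apply,
      sub_apply, sub_eq_sub_iff_sub_eq_sub,
      h.torsionless _ _ p hp (hed l) (hed k), h'.torsionless _ _ p hp (hed l) (hed k)]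
  have hoff : ∀ j k v, j ≠ k → ξ j p (A (e k p) v) = 0 := by
    intro j k v hjk
    rw [hAX _ (hed k), sub_apply, map_sub,
      h.parallel_fol _ ξ e he p hp hpφ v j k hjk, h'.parallel_fol _ ξ e he p hp hpφ v j k hjk,
      sub_zero]
  have htr : ∀ v, ∑ k, ξ k p (A (e k p) v) = 0 := by
    intro v
    have : ∀ k, ξ k p (A (e k p) v) = ξ k p (D (e k) p v) - ξ k p (D' (e k) p v) := fun k => by
      rw [hAX _ (hed k), sub_apply, map_sub]
    simp only [this, Finset.sum_sub_distrib, h.parallel_vol _ ξ e he p hp hpφ v,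
      h'.parallel_vol _ ξ e he p hp hpφ v, sub_zero]
  have hdiag : ∀ l, ξ l p (A (e l p) (e l p)) = 0 := by
    intro l
    have h1 := htr (e l p)
    rwa [Finset.sum_eq_single l
      (fun k _ hkl => by rw [hsymm]; exact hoff k l _ hkl)
      (fun hl => absurd (Finset.mem_univ l) hl)] at h1
  have hzero : ∀ k l, A (e k p) (e l p) = 0 := by
    intro k l
    refine he.eq_zero hpφ fun j => ?_
    by_cases hjk : j = k
    · by_cases hjl : j = l
      · subst hjk; subst hjl
        exact hdiag j
      · rw [hsymm]
        exact hoff j l _ hjl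
    · exact hoff j k _ hjk
  have hA0 : A (X p) = 0 := by
    ext v
    rw [← he.sum_smul hpφ (X p), ← he.sum_smul hpφ v]
    simp [hzero]
  rw [hAX X hX, sub_eq_zero] at hA0
  exact hA0

end Uniqueness

/-! ### Connections with diagonal Christoffel symbols. -/

section CoordinateConnections

variable {n : ℕ}

/-- The covariant derivative on `ℝⁿ` whose only nonzero Christoffel symbols are `Γᵏₖₖ = γₖ`. -/
def coordConn (γ : Fin n → Euc n → ℝ) (V : Euc n → Euc n) (x : Euc n) : Euc n →L[ℝ] Euc n :=
  fderiv ℝ V x + ∑ k, (γ k x * V x k) •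
    (EuclideanSpace.proj k : Euc n →L[ℝ] ℝ).smulRight (stdVec k : Euc n)

theorem coordConn_apply (γ : Fin n → Euc n → ℝ) (V : Euc n → Euc n) (x w : Euc n) (k : Fin n) :
    coordConn γ V x w k = fderiv ℝ V x w k + γ k x * V x k * w k := by
  simp [coordConn, stdVec_apply, Finset.sum_apply]

theorem sum_smul_stdVec (w : Euc n) : ∑ k, w k • (stdVec k : Euc n) = w := by
  ext j
  simp [stdVec_apply]

theorem fderiv_coord {V : Euc n → Euc n} {x : Euc n} (hV : DifferentiableAt ℝ V x) (w : Euc n)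
    (k : Fin n) : fderiv ℝ (fun y => V y k) x w = fderiv ℝ V x w k := by
  have h := (EuclideanSpace.proj k : Euc n →L[ℝ] ℝ).hasFDerivAt.comp x hV.hasFDerivAt
  exact congrArg (fun L => L w) h.fderiv

variable {M : Type*} [TopologicalSpace M] [ChartedSpace (Euc n) M]
  {φ : OpenPartialHomeomorph M (Euc n)}

/-- The connection which is given in the coordinates `φ` by `coordConn γ`. -/
def chartConn (γ : Fin n → Euc n → ℝ) (φ : OpenPartialHomeomorph M (Euc n))
    (X : (p : M) → Tan n p) (p : M) : Tan n p →L[ℝ] Tan n p :=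
  chartInv φ p ∘L coordConn γ (chartRep φ X) (φ p) ∘L chartDeriv φ p

theorem chartConn_apply (γ : Fin n → Euc n → ℝ) (X : (p : M) → Tan n p) (p : M) (v : Tan n p) :
    chartConn γ φ X p v = chartInv φ p (coordConn γ (chartRep φ X) (φ p) (chartDeriv φ p v)) :=
  rfl

theorem chartDeriv_injective (hφ : φ ∈ IsManifold.maximalAtlas 𝓘(ℝ, Euc n) ∞ M) {p : M}
    (hp : p ∈ φ.source) {u v : Tan n p} (h : chartDeriv φ p u = chartDeriv φ p v) : u = v := by
  rw [← chartInv_chartDeriv hφ hp u, h, chartInv_chartDeriv hφ hp]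

theorem chartDeriv_chartConn (hφ : φ ∈ IsManifold.maximalAtlas 𝓘(ℝ, Euc n) ∞ M)
    (γ : Fin n → Euc n → ℝ) (X : (p : M) → Tan n p) {p : M} (hp : p ∈ φ.source) (v : Tan n p) :
    chartDeriv φ p (chartConn γ φ X p v) =
      coordConn γ (chartRep φ X) (φ p) (chartDeriv φ p v) := by
  rw [chartConn_apply, chartDeriv_chartInv hφ hp]

theorem mdifferentiableAt_comp_symm (hφ : φ ∈ IsManifold.maximalAtlas 𝓘(ℝ, Euc n) ∞ M) {p : M}
    (hp : p ∈ φ.source) {g : M → ℝ} (hg : MDifferentiableAt 𝓘(ℝ, Euc n) 𝓘(ℝ, ℝ) g p) :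
    DifferentiableAt ℝ (g ∘ φ.symm) (φ p) ∧ ∀ v : Tan n p,
      mvfderiv 𝓘(ℝ, Euc n) g p v = fderiv ℝ (g ∘ φ.symm) (φ p) (chartDeriv φ p v) := by
  have hd := mdifferentiable_of_mem_maximalAtlas hφ
  have hgs : MDifferentiableAt 𝓘(ℝ, Euc n) 𝓘(ℝ, ℝ) (g ∘ φ.symm) (φ p) :=
    MDifferentiableAt.comp (φ p) (by rwa [φ.left_inv hp])
      (hd.mdifferentiableAt_symm (φ.map_source hp))
  refine ⟨hgs.differentiableAt, fun v => ?_⟩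
  have h1 : mfderiv 𝓘(ℝ, Euc n) 𝓘(ℝ, ℝ) ((g ∘ φ.symm) ∘ φ) p =
      (mfderiv 𝓘(ℝ, Euc n) 𝓘(ℝ, ℝ) (g ∘ φ.symm) (φ p)).comp
        (mfderiv 𝓘(ℝ, Euc n) 𝓘(ℝ, Euc n) φ p) :=
    mfderiv_comp p hgs (hd.mdifferentiableAt hp)
  have h2 : mfderiv 𝓘(ℝ, Euc n) 𝓘(ℝ, ℝ) ((g ∘ φ.symm) ∘ φ) p =
      mfderiv 𝓘(ℝ, Euc n) 𝓘(ℝ, ℝ) g p := by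
    refine Filter.EventuallyEq.mfderiv_eq ?_
    filter_upwards [φ.open_source.mem_nhds hp] with q hq
    simp [φ.left_inv hq]
  rw [mfderiv_eq_fderiv] at h1
  exact congrArg (fun L => L v) (h2.symm.trans h1)

variable [IsManifold 𝓘(ℝ, Euc n) ∞ M]

/-- The Christoffel term is linear in the value of the field at the point, so the Leibniz rule comes
from the ordinary derivative alone; no condition on `γ` enters. -/
theorem isCovariantDerivativeOn_chartConn (hφ : φ ∈ IsManifold.maximalAtlas 𝓘(ℝ, Euc n) ∞ M)
    (γ : Fin n → Euc n → ℝ) :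
    IsCovariantDerivativeOn (I := 𝓘(ℝ, Euc n)) (Euc n) (V := fun p : M => Tan n p)
      (chartConn γ φ) φ.source where
  add {X Y p} hX hY hp := by
    have hX' := differentiableAt_chartRep hφ hp hX
    have hY' := differentiableAt_chartRep hφ hp hY
    have h1 : chartRep φ (X + Y) = chartRep φ X + chartRep φ Y :=
      funext fun x => map_add (chartDeriv φ (φ.symm x)) _ _
    ext v
    refine chartDeriv_injective hφ hp ?_
    rw [add_apply, map_add, chartDeriv_chartConn hφ γ _ hp, chartDeriv_chartConn hφ γ _ hp,
      chartDeriv_chartConn hφ γ _ hp, h1]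
    ext k
    rw [PiLp.add_apply, coordConn_apply, coordConn_apply, coordConn_apply, fderiv_add hX' hY']
    simp only [add_apply, PiLp.add_apply, Pi.add_apply]
    ring
  leibniz {X g p} hX hg hp := by
    have hX' := differentiableAt_chartRep hφ hp hX
    obtain ⟨hg', hdg⟩ := mdifferentiableAt_comp_symm hφ hp hg
    have h1 : chartRep φ (g • X) = (g ∘ φ.symm) • chartRep φ X :=
      funext fun x => map_smul (chartDeriv φ (φ.symm x)) _ _
    ext v
    refine chartDeriv_injective hφ hp ?_
    rw [add_apply, map_add, smul_apply, map_smul, ContinuousLinearMap.smulRight_apply, map_smul,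
      chartDeriv_chartConn hφ γ _ hp, chartDeriv_chartConn hφ γ _ hp, h1, hdg]
    ext k
    rw [PiLp.add_apply, PiLp.smul_apply, PiLp.smul_apply, coordConn_apply, coordConn_apply,
      fderiv_smul hg' hX', ← chartRep_apply X hp]
    simp only [add_apply, PiLp.add_apply, Pi.smul_apply', smul_apply, PiLp.smul_apply,
      ContinuousLinearMap.smulRight_apply, smul_eq_mul, Function.comp_apply, φ.left_inv hp]
    ring

end CoordinateConnections

/-! ### The web connection of an adapted chart. -/

section WebConnections

variable {n : ℕ} {M : Type*} [TopologicalSpace M] [ChartedSpace (Euc n) M]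
  [IsManifold 𝓘(ℝ, Euc n) ∞ M] {W : DivFreeWeb n M} {φ : OpenPartialHomeomorph M (Euc n)}

/-- The partial derivatives `∂ log |h| / ∂xₖ`. -/
def DivFreeWeb.logDensityPartial (W : DivFreeWeb n M) (φ : OpenPartialHomeomorph M (Euc n))
    (k : Fin n) (x : Euc n) : ℝ :=
  fderiv ℝ (fun y => Real.log |W.density φ y|) x (stdVec k)

/-- Both kernels are `T_p Fᵢ`. Hence `ξⁱ` is a multiple of `dxᵢ`. -/
theorem DivFreeWeb.IsAdaptedChart.coordDiff_coframe (hφ : W.IsAdaptedChart φ) {V : Set M}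
    {ξ : Fin n → (p : M) → Tan n p →L[ℝ] ℝ} {e : Fin n → (p : M) → Tan n p}
    (h : W.IsAdaptedCoframe V ξ e) {p : M} (hp : p ∈ φ.source) (hpV : p ∈ V) (i : Fin n)
    (v : Tan n p) : coordDiff φ i p v = 0 ↔ ξ i p v = 0 := by
  have h1 := (hφ i).leafTangent_eq hp
  have h2 := h.tangent_eq p hpV i
  rw [Foliation.tangent, h1] at h2
  exact Submodule.ext_iff.1 h2 v

/-- The Christoffel symbols are symmetric, which gives zero torsion. An adapted frame is `eₖ = cₖ
∂ₖ`, whose derivative is again a multiple of `∂ₖ`; the connection form is `d log |cₖ| + γₖ dxₖ`, and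
these sum to `d log |h ∏ cₖ| = 0`. -/
theorem DivFreeWeb.IsAdaptedChart.isLocalWebConnection (hφ : W.IsAdaptedChart φ) (hn : 1 ≤ n) :
    W.IsLocalWebConnection (chartConn (W.logDensityPartial φ) φ) φ.source := by
  have hm := hφ.mem_atlas hn
  -- The frame is diagonal on a neighbourhood, not merely at `p`, because its components are
  -- differentiated below.
  have hrep : ∀ V ξ e, W.IsAdaptedCoframe V ξ e → ∀ p ∈ φ.source, p ∈ V →
      ∀ᶠ x in 𝓝 (φ p), ∀ j k, j ≠ k → chartRep φ (e k) x j = 0 := by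
    intro V ξ e h p hp hpV
    filter_upwards [(φ.symm.isOpen_inter_preimage h.isOpen).mem_nhds
      ⟨φ.map_source hp, by simpa [φ.left_inv hp] using hpV⟩] with x hx j k hjk
    change coordDiff φ j (φ.symm x) (e k (φ.symm x)) = 0
    rw [hφ.coordDiff_coframe h (φ.map_target hx.1) hx.2, h.dual _ hx.2, if_neg hjk]
  have hdiff : ∀ V ξ e, W.IsAdaptedCoframe V ξ e → ∀ p ∈ φ.source, p ∈ V → ∀ k,
      DifferentiableAt ℝ (chartRep φ (e k)) (φ p) := fun V ξ e h p hp hpV k =>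
    differentiableAt_chartRep hm hp
      (((h.smooth k).contMDiffAt (h.isOpen.mem_nhds hpV)).mdifferentiableAt (by simp))
  refine ⟨isCovariantDerivativeOn_chartConn hm _, fun X Y p hp hX hY => ?_,
    fun V ξ e h p hp hpV v j k hjk => ?_, fun V ξ e h p hp hpV v => ?_⟩
  · refine chartDeriv_injective hm hp ?_
    rw [map_sub, chartDeriv_chartConn hm _ _ hp, chartDeriv_chartConn hm _ _ hp,
      chartRep_mlieBracket hm hp hX hY, ← chartRep_apply X hp, ← chartRep_apply Y hp]
    ext k
    rw [PiLp.sub_apply, PiLp.sub_apply, coordConn_apply, coordConn_apply]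
    ring
  · rw [← hφ.coordDiff_coframe h hp hpV, coordDiff_apply, chartDeriv_chartConn hm _ _ hp,
      coordConn_apply, (hrep V ξ e h p hp hpV).self_of_nhds j k hjk,
      ← fderiv_coord (hdiff V ξ e h p hp hpV k)]
    have h1 : (fun y => chartRep φ (e k) y j) =ᶠ[𝓝 (φ p)] fun _ => 0 :=
      (hrep V ξ e h p hp hpV).mono fun x hx => hx j k hjk
    rw [h1.fderiv_eq]
    simp
  · set c : Fin n → Euc n → ℝ := fun k x => chartRep φ (e k) x k with hc
    have hcd : ∀ k, DifferentiableAt ℝ (c k) (φ p) := fun k =>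
      (EuclideanSpace.proj k : Euc n →L[ℝ] ℝ).differentiableAt.comp _ (hdiff V ξ e h p hp hpV k)
    -- The volume form takes the value 1 on an adapted frame; in coordinates this value is `h` times
    -- a diagonal determinant.
    have hvol : ∀ᶠ x in 𝓝 (φ p), W.density φ x * ∏ k, c k x = 1 := by
      filter_upwards [(φ.symm.isOpen_inter_preimage h.isOpen).mem_nhds
        ⟨φ.map_source hp, by simpa [φ.left_inv hp] using hpV⟩] with x hx
      have h1 := h.vol_eq _ hx.2 fun k => e k (φ.symm x)
      rw [W.vol_eq_density_mul_det hm (φ.map_target hx.1), φ.right_inv hx.1] at h1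
      have h2 : (Matrix.of fun j k => coordDiff φ j (φ.symm x) (e k (φ.symm x))) =
          Matrix.diagonal fun k => c k x := by
        ext j k
        rw [Matrix.diagonal_apply]
        split_ifs with hjk
        · subst hjk; rfl
        · change coordDiff φ j (φ.symm x) (e k (φ.symm x)) = 0
          rw [hφ.coordDiff_coframe h (φ.map_target hx.1) hx.2, h.dual _ hx.2, if_neg hjk]
      have h3 : (Matrix.of fun j k => ξ j (φ.symm x) (e k (φ.symm x))) = 1 := by
        ext j k
        rw [Matrix.one_apply, ← h.dual _ hx.2]
        rfl
      have h4 : W.density φ x *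
          Matrix.det (Matrix.of fun j k => coordDiff φ j (φ.symm x) (e k (φ.symm x))) =
          Matrix.det (Matrix.of fun j k => ξ j (φ.symm x) (e k (φ.symm x))) := h1
      rwa [h2, h3, Matrix.det_diagonal, Matrix.det_one] at h4
    have hc0 : ∀ k, c k (φ p) ≠ 0 := by
      intro k hk
      have := hvol.self_of_nhds
      rw [Finset.prod_eq_zero (f := fun k => c k (φ p)) (Finset.mem_univ k) hk, mul_zero] at this
      exact zero_ne_one this
    -- `Real.log` ignores signs, so the `cₖ` need no absolute values.
    have hlog : (fun x => Real.log |W.density φ x|) =ᶠ[𝓝 (φ p)]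
        fun x => -∑ k, Real.log (c k x) := by
      filter_upwards [hvol] with x hx
      have h1 : ∀ k ∈ Finset.univ, c k x ≠ 0 := by
        intro k _ hk
        rw [Finset.prod_eq_zero (f := fun k => c k x) (Finset.mem_univ k) hk, mul_zero] at hx
        exact zero_ne_one hx
      rw [← Real.log_prod h1, Real.log_abs, eq_inv_of_mul_eq_one_left hx, Real.log_inv]
    set w : Euc n := chartDeriv φ p v with hw
    have hd : ∑ k, W.logDensityPartial φ k (φ p) * w k =
        -∑ k, (c k (φ p))⁻¹ * fderiv ℝ (c k) (φ p) w := by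
      have h1 : ∑ k, W.logDensityPartial φ k (φ p) * w k =
          fderiv ℝ (fun x => Real.log |W.density φ x|) (φ p) w := by
        conv_rhs => rw [← sum_smul_stdVec w, map_sum]
        refine Finset.sum_congr rfl fun k _ => ?_
        rw [map_smul, smul_eq_mul, mul_comm]
        rfl
      have h2 : HasFDerivAt (fun x => -∑ k, Real.log (c k x))
          (-∑ k, (c k (φ p))⁻¹ • fderiv ℝ (c k) (φ p)) (φ p) :=
        (HasFDerivAt.fun_sum fun k _ => (hcd k).hasFDerivAt.log (hc0 k)).neg
      rw [h1, hlog.fderiv_eq, h2.fderiv]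
      simp
    -- The two covectors have the same kernel, so comparing their values on `eₖ` fixes the factor.
    have hξ : ∀ k, ∀ u : Tan n p, ξ k p u = (c k (φ p))⁻¹ * coordDiff φ k p u := by
      intro k u
      have h1 : coordDiff φ k p (u - (c k (φ p))⁻¹ • coordDiff φ k p u • e k p) = 0 := by
        have : coordDiff φ k p (e k p) = c k (φ p) := by
          simp only [hc]
          rw [chartRep_apply _ hp]
          rfl
        rw [map_sub, map_smul, map_smul, this, smul_eq_mul, smul_eq_mul]
        field_simp [hc0 k]
        ring
      rw [hφ.coordDiff_coframe h hp hpV, map_sub, map_smul, map_smul, h.dual p hpV, if_pos rfl,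
        sub_eq_zero] at h1
      simpa using h1
    have hterm : ∀ k, ξ k p (chartConn (W.logDensityPartial φ) φ (e k) p v) =
        (c k (φ p))⁻¹ * fderiv ℝ (c k) (φ p) w + W.logDensityPartial φ k (φ p) * w k := by
      intro k
      rw [hξ, coordDiff_apply, chartDeriv_chartConn hm _ _ hp, coordConn_apply,
        ← fderiv_coord (hdiff V ξ e h p hp hpV k), mul_add]
      congr 1
      change (c k (φ p))⁻¹ * (_ * c k (φ p) * _) = _
      field_simp [hc0 k]
      rw [hw]
    simp only [hterm, Finset.sum_add_distrib, hd, add_neg_cancel]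

end WebConnections

/-! ### Smoothness of the connection. -/

section Smoothness

variable {n : ℕ} {M : Type*} [TopologicalSpace M] [ChartedSpace (Euc n) M]

theorem contMDiffAt_clm_of_apply_stdVec {A : M → Euc n →L[ℝ] Euc n} {p : M}
    (h : ∀ k, ContMDiffAt 𝓘(ℝ, Euc n) 𝓘(ℝ, Euc n) ∞ (fun q => A q (stdVec k)) p) :
    ContMDiffAt 𝓘(ℝ, Euc n) 𝓘(ℝ, Euc n →L[ℝ] Euc n) ∞ A p := by
  have e : A = fun q => ∑ k, ContinuousLinearMap.smulRightL ℝ (Euc n) (Euc n)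
      (EuclideanSpace.proj k : Euc n →L[ℝ] ℝ) (A q (stdVec k)) := by
    funext q
    ext w : 1
    conv_lhs => rw [← sum_smul_stdVec w, map_sum]
    rw [sum_apply]
    exact Finset.sum_congr rfl fun k _ => map_smul _ _ _
  rw [e]
  exact ContMDiffAt.sum fun k _ => (ContinuousLinearMap.smulRightL ℝ (Euc n) (Euc n)
      (EuclideanSpace.proj k : Euc n →L[ℝ] ℝ)).contMDiff.contMDiffAt.comp p (h k)

variable {φ : OpenPartialHomeomorph M (Euc n)}

theorem contDiffAt_coordConn {γ : Fin n → Euc n → ℝ} {V Y : Euc n → Euc n} {x : Euc n}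
    (hγ : ∀ k, ContDiffAt ℝ ∞ (γ k) x) (hV : ContDiffAt ℝ ∞ V x) (hY : ContDiffAt ℝ ∞ Y x) :
    ContDiffAt ℝ ∞ (fun y => coordConn γ V y (Y y)) x := by
  have hk : ∀ {Z : Euc n → Euc n}, ContDiffAt ℝ ∞ Z x → ∀ k, ContDiffAt ℝ ∞ (fun y => Z y k) x :=
    fun hZ k => (EuclideanSpace.proj k : Euc n →L[ℝ] ℝ).contDiff.contDiffAt.comp x hZ
  have h1 : ContDiffAt ℝ ∞ (fun y => fderiv ℝ V y (Y y)) x :=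
    (hV.fderiv_right (m := ∞) (by simp)).clm_apply hY
  rw [contDiffAt_piLp]
  intro k
  have e : (fun y => coordConn γ V y (Y y) k) =
      fun y => fderiv ℝ V y (Y y) k + γ k y * V y k * Y y k :=
    funext fun y => coordConn_apply γ V y (Y y) k
  rw [e]
  exact (hk h1 k).add (((hγ k).mul (hk hV k)).mul (hk hY k))

theorem chartConn_field (γ : Fin n → Euc n → ℝ)
    (X Y : (p : M) → Tan n p) {q : M} (hq : q ∈ φ.source) :
    chartConn γ φ X q (Y q) =
      chartLift φ (fun x => coordConn γ (chartRep φ X) x (chartRep φ Y x)) q := by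
  rw [chartConn_apply, ← chartRep_apply Y hq]
  rfl

variable [IsManifold 𝓘(ℝ, Euc n) ∞ M]

/-- A field of endomorphisms of the tangent spaces is smooth if it takes smooth vector fields to
smooth vector fields. -/
theorem contMDiffAt_hom_of_apply {L : (p : M) → Tan n p →L[ℝ] Tan n p} {p : M}
    (h : ∀ Y : (q : M) → Tan n q, ContMDiffAt 𝓘(ℝ, Euc n) 𝓘(ℝ, Euc n).tangent ∞
        (fun q => (⟨q, Y q⟩ : TangentBundle 𝓘(ℝ, Euc n) M)) p →
      ContMDiffAt 𝓘(ℝ, Euc n) 𝓘(ℝ, Euc n).tangent ∞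
        (fun q => (⟨q, L q (Y q)⟩ : TangentBundle 𝓘(ℝ, Euc n) M)) p) :
    ContMDiffAt 𝓘(ℝ, Euc n) (𝓘(ℝ, Euc n).prod 𝓘(ℝ, Euc n →L[ℝ] Euc n)) ∞
      (fun q => (⟨q, L q⟩ : Bundle.TotalSpace (Euc n →L[ℝ] Euc n)
        fun q : M => Tan n q →L[ℝ] Tan n q)) p := by
  rw [contMDiffAt_hom_bundle]
  refine ⟨contMDiffAt_id, contMDiffAt_clm_of_apply_stdVec fun k => ?_⟩
  -- The test fields are constant in the trivialization, so `L` applied to them gives the columns of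
  -- its matrix.
  set t := trivializationAt (Euc n) (TangentSpace 𝓘(ℝ, Euc n) : M → Type) p with ht
  have hY : ContMDiffAt 𝓘(ℝ, Euc n) 𝓘(ℝ, Euc n).tangent ∞
      (fun q => (⟨q, t.symm q (stdVec k)⟩ : TangentBundle 𝓘(ℝ, Euc n) M)) p := by
    rw [Bundle.contMDiffAt_section]
    refine (contMDiffAt_const (c := (stdVec k : Euc n))).congr_of_eventuallyEq ?_
    filter_upwards [t.open_baseSet.mem_nhds (FiberBundle.mem_baseSet_trivializationAt' p)]
      with q hq
    simp [← ht, hq]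
  have h2 := h _ hY
  rw [Bundle.contMDiffAt_section] at h2
  refine h2.congr_of_eventuallyEq ?_
  filter_upwards [t.open_baseSet.mem_nhds (FiberBundle.mem_baseSet_trivializationAt' p)] with q hq
  simp only [ContinuousLinearMap.inCoordinates, ← ht, ContinuousLinearMap.comp_apply]
  rw [Bundle.Trivialization.symmL_apply (hb := hq),
    Bundle.Trivialization.continuousLinearMapAt_apply (R := ℝ)]
  exact congrFun (t.coe_linearMapAt_of_mem (R := ℝ) hq) _

theorem contMDiffAt_chartConn (hφ : φ ∈ IsManifold.maximalAtlas 𝓘(ℝ, Euc n) ∞ M)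
    {γ : Fin n → Euc n → ℝ} {p : M} (hp : p ∈ φ.source)
    (hγ : ∀ k, ContDiffAt ℝ ∞ (γ k) (φ p)) {X Y : (p : M) → Tan n p}
    (hX : ContMDiffAt 𝓘(ℝ, Euc n) 𝓘(ℝ, Euc n).tangent ∞
      (fun q => (⟨q, X q⟩ : TangentBundle 𝓘(ℝ, Euc n) M)) p)
    (hY : ContMDiffAt 𝓘(ℝ, Euc n) 𝓘(ℝ, Euc n).tangent ∞
      (fun q => (⟨q, Y q⟩ : TangentBundle 𝓘(ℝ, Euc n) M)) p) :
    ContMDiffAt 𝓘(ℝ, Euc n) 𝓘(ℝ, Euc n).tangent ∞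
      (fun q => (⟨q, chartConn γ φ X q (Y q)⟩ : TangentBundle 𝓘(ℝ, Euc n) M)) p := by
  refine (contMDiffAt_chartLift hφ hp (contDiffAt_coordConn hγ (contDiffAt_chartRep hφ hp hX)
    (contDiffAt_chartRep hφ hp hY))).congr_of_eventuallyEq ?_
  filter_upwards [φ.open_source.mem_nhds hp] with q hq
  rw [chartConn_field γ X Y hq]

variable {W : DivFreeWeb n M}

theorem DivFreeWeb.contDiffAt_logDensityPartial (W : DivFreeWeb n M)
    (hφ : φ ∈ IsManifold.maximalAtlas 𝓘(ℝ, Euc n) ∞ M) {x : Euc n} (hx : x ∈ φ.target)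
    (k : Fin n) : ContDiffAt ℝ ∞ (W.logDensityPartial φ k) x :=
  (((W.contDiffOn_log_density hφ).contDiffAt (φ.open_target.mem_nhds hx)).fderiv_right
    (m := ∞) (by simp)).clm_apply contDiffAt_const

end Smoothness

/-! ### Existence by gluing. -/

section Existence

variable {n : ℕ} {M : Type*} [TopologicalSpace M] [ChartedSpace (Euc n) M]
  [IsManifold 𝓘(ℝ, Euc n) ∞ M] {W : DivFreeWeb n M}

theorem DivFreeWeb.IsLocalWebConnection.mono
    {D : ((p : M) → Tan n p) → (p : M) → Tan n p →L[ℝ] Tan n p} {U V : Set M}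
    (h : W.IsLocalWebConnection D U) (hV : V ⊆ U) : W.IsLocalWebConnection D V where
  isCovariantDerivativeOn := h.isCovariantDerivativeOn.mono hV
  torsionless X Y p hp := h.torsionless X Y p (hV hp)
  parallel_fol A ξ e he p hp := h.parallel_fol A ξ e he p (hV hp)
  parallel_vol A ξ e he p hp := h.parallel_vol A ξ e he p (hV hp)

/-- The connections of the adapted charts, glued along the choice of one chart at each point. -/
def DivFreeWeb.gluedConn (W : DivFreeWeb n M) (X : (p : M) → Tan n p) (p : M) :
    Tan n p →L[ℝ] Tan n p :=
  chartConn (W.logDensityPartial (W.exists_adaptedChart p).choose)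
    (W.exists_adaptedChart p).choose X p

/-- Uniqueness on the overlap of two adapted charts removes the dependence on the chosen chart. This
is what makes the glued connection smooth, since the choice varies arbitrarily with the point. -/
theorem DivFreeWeb.gluedConn_eq (W : DivFreeWeb n M) (hn : 1 ≤ n)
    {φ : OpenPartialHomeomorph M (Euc n)} (hφ : W.IsAdaptedChart φ) {q : M} (hq : q ∈ φ.source)
    {X : (p : M) → Tan n p}
    (hX : MDifferentiableAt 𝓘(ℝ, Euc n) 𝓘(ℝ, Euc n).tangent
      (fun q => (⟨q, X q⟩ : TangentBundle 𝓘(ℝ, Euc n) M)) q) :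
    W.gluedConn X q = chartConn (W.logDensityPartial φ) φ X q := by
  obtain ⟨h1, -, h2⟩ := (W.exists_adaptedChart q).choose_spec
  exact ((h2.isLocalWebConnection hn).mono Set.inter_subset_left).eq hn
    ((hφ.isLocalWebConnection hn).mono Set.inter_subset_right) ⟨h1, hq⟩ hX

/-- Every clause concerns the connection at one point, so it is inherited from the chart chosen
there. -/
theorem DivFreeWeb.isLocalWebConnection_gluedConn (W : DivFreeWeb n M) (hn : 1 ≤ n) :
    W.IsLocalWebConnection W.gluedConn Set.univ where
  isCovariantDerivativeOn :=
    { add := fun {_ _ p} hX hY _ =>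
        ((W.exists_adaptedChart p).choose_spec.2.2.isLocalWebConnection
          hn).isCovariantDerivativeOn.add hX hY (W.exists_adaptedChart p).choose_spec.1
      leibniz := fun {_ _ p} hX hg _ =>
        ((W.exists_adaptedChart p).choose_spec.2.2.isLocalWebConnection
          hn).isCovariantDerivativeOn.leibniz hX hg (W.exists_adaptedChart p).choose_spec.1 }
  torsionless X Y p _ :=
    ((W.exists_adaptedChart p).choose_spec.2.2.isLocalWebConnection hn).torsionless X Y p
      (W.exists_adaptedChart p).choose_spec.1
  parallel_fol V ξ e h p _ :=
    ((W.exists_adaptedChart p).choose_spec.2.2.isLocalWebConnection hn).parallel_fol V ξ e h p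
      (W.exists_adaptedChart p).choose_spec.1
  parallel_vol V ξ e h p _ :=
    ((W.exists_adaptedChart p).choose_spec.2.2.isLocalWebConnection hn).parallel_vol V ξ e h p
      (W.exists_adaptedChart p).choose_spec.1

theorem DivFreeWeb.exists_isWebConnection (W : DivFreeWeb n M) (hn : 1 ≤ n) :
    ∃ D : AffineConnection n M, W.IsWebConnection D := by
  have h := W.isLocalWebConnection_gluedConn hn
  refine ⟨⟨W.gluedConn, h.isCovariantDerivativeOn⟩, ⟨⟨⟨?_⟩⟩, ?_, ?_, ?_⟩⟩
  · intro X hX p _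
    have hX' : ∀ q, ContMDiffAt 𝓘(ℝ, Euc n) 𝓘(ℝ, Euc n).tangent ∞
        (fun q => (⟨q, X q⟩ : TangentBundle 𝓘(ℝ, Euc n) M)) q := fun q =>
      hX.contMDiffAt Filter.univ_mem
    obtain ⟨φ, hp, -, hφ⟩ := W.exists_adaptedChart p
    have hm := hφ.mem_atlas hn
    refine (contMDiffAt_hom_of_apply fun Y hY => ?_).contMDiffWithinAt
    refine (contMDiffAt_chartConn hm hp (fun k =>
      W.contDiffAt_logDensityPartial hm (φ.map_source hp) k) (hX' p) hY).congr_of_eventuallyEq ?_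
    filter_upwards [φ.open_source.mem_nhds hp] with q hq
    rw [W.gluedConn_eq hn hφ hq ((hX' q).mdifferentiableAt (by simp))]
  · rw [CovariantDerivative.torsion_eq_zero_iff]
    intro X Y p hX hY
    exact h.torsionless X Y p trivial hX hY
  · exact fun V ξ e he p hp => h.parallel_fol V ξ e he p trivial hp
  · exact fun V ξ e he p hp => h.parallel_vol V ξ e he p trivial hp

end Existence

/-! ### Curvature in coordinates. -/

section CoordinateCurvature

variable {n : ℕ}

theorem fderiv_coordConn_apply {γ : Fin n → Euc n → ℝ} {V Y : Euc n → Euc n} {x : Euc n}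
    (hγ : ∀ k, ContDiffAt ℝ ∞ (γ k) x) (hV : ContDiffAt ℝ ∞ V x) (hY : ContDiffAt ℝ ∞ Y x)
    (w : Euc n) (k : Fin n) :
    fderiv ℝ (fun y => coordConn γ V y (Y y)) x w k =
      fderiv ℝ (fderiv ℝ V) x w (Y x) k + fderiv ℝ V x (fderiv ℝ Y x w) k +
        (fderiv ℝ (γ k) x w * V x k * Y x k + γ k x * fderiv ℝ V x w k * Y x k +
          γ k x * V x k * fderiv ℝ Y x w k) := by
  have hdV : DifferentiableAt ℝ V x := hV.differentiableAt (by simp)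
  have hdY : DifferentiableAt ℝ Y x := hY.differentiableAt (by simp)
  have hdγ : DifferentiableAt ℝ (γ k) x := (hγ k).differentiableAt (by simp)
  have hddV : DifferentiableAt ℝ (fderiv ℝ V) x :=
    (hV.fderiv_right (m := ∞) (by simp)).differentiableAt (by simp)
  have hk : ∀ {Z : Euc n → Euc n}, DifferentiableAt ℝ Z x →
      HasFDerivAt (fun y => Z y k)
        ((EuclideanSpace.proj k : Euc n →L[ℝ] ℝ).comp (fderiv ℝ Z x)) x :=
    fun hZ => (EuclideanSpace.proj k : Euc n →L[ℝ] ℝ).hasFDerivAt.comp x hZ.hasFDerivAt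
  have h1 : DifferentiableAt ℝ (fun y => fderiv ℝ V y (Y y)) x := hddV.clm_apply hdY
  rw [← fderiv_coord ((contDiffAt_coordConn hγ hV hY).differentiableAt (by simp))]
  have e : (fun y => coordConn γ V y (Y y) k) =
      fun y => fderiv ℝ V y (Y y) k + γ k y * V y k * Y y k :=
    funext fun y => coordConn_apply γ V y (Y y) k
  rw [e, ((hk h1).fun_add ((hdγ.hasFDerivAt.fun_mul (hk hdV)).fun_mul (hk hdY))).fderiv,
    fderiv_clm_apply hddV hdY]
  simp
  ring

/-- Second derivatives of `C` cancel by symmetry and the derivatives of `A` and `B` by the bracket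
term. The terms containing `γₖ` itself cancel because each component is differentiated as for a line
bundle; only `dγₖ` survives. -/
theorem coordConn_curvature {γ : Fin n → Euc n → ℝ} {A B C : Euc n → Euc n} {x : Euc n}
    (hγ : ∀ k, ContDiffAt ℝ ∞ (γ k) x) (hA : ContDiffAt ℝ ∞ A x) (hB : ContDiffAt ℝ ∞ B x)
    (hC : ContDiffAt ℝ ∞ C x) (k : Fin n) :
    coordConn γ (fun y => coordConn γ C y (B y)) x (A x) k -
        coordConn γ (fun y => coordConn γ C y (A y)) x (B x) k -
        coordConn γ C x (fderiv ℝ B x (A x) - fderiv ℝ A x (B x)) k =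
      C x k * (fderiv ℝ (γ k) x (A x) * B x k - fderiv ℝ (γ k) x (B x) * A x k) := by
  have hsymm : fderiv ℝ (fderiv ℝ C) x (A x) (B x) = fderiv ℝ (fderiv ℝ C) x (B x) (A x) :=
    (hC.isSymmSndFDerivAt (by simpa using two_le_infty)).eq _ _
  rw [coordConn_apply, coordConn_apply, coordConn_apply, fderiv_coordConn_apply hγ hC hB,
    fderiv_coordConn_apply hγ hC hA, coordConn_apply, coordConn_apply, hsymm, map_sub]
  simp only [PiLp.sub_apply]
  ring

/-- The curvature tensor of the connection `coordConn γ` at `x`, as an endomorphism in its second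
argument. -/
def coordCurvature (γ : Fin n → Euc n → ℝ) (x a c : Euc n) : Euc n →ₗ[ℝ] Euc n where
  toFun b := WithLp.toLp 2 fun k => c k * (fderiv ℝ (γ k) x a * b k - fderiv ℝ (γ k) x b * a k)
  map_add' b b' := by
    ext k
    simp only [PiLp.add_apply, map_add]
    ring
  map_smul' r b := by
    ext k
    simp only [PiLp.smul_apply, map_smul, smul_eq_mul, RingHom.id_apply]
    ring

theorem coordCurvature_apply (γ : Fin n → Euc n → ℝ) (x a c b : Euc n) (k : Fin n) :
    coordCurvature γ x a c b k =
      c k * (fderiv ℝ (γ k) x a * b k - fderiv ℝ (γ k) x b * a k) := rfl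

theorem trace_euclidean (T : Euc n →ₗ[ℝ] Euc n) :
    LinearMap.trace ℝ (Euc n) T = ∑ j, T (stdVec j) j := by
  rw [LinearMap.trace_eq_matrix_trace ℝ (EuclideanSpace.basisFun (Fin n) ℝ).toBasis]
  simp [Matrix.trace, LinearMap.toMatrix_apply, stdVec]

end CoordinateCurvature

/-! ### Curvature and Ricci tensor of the web connection. -/

section Curvature

variable {n : ℕ} {M : Type*} [TopologicalSpace M] [ChartedSpace (Euc n) M]
  [IsManifold 𝓘(ℝ, Euc n) ∞ M] {W : DivFreeWeb n M} {D : AffineConnection n M}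
  {φ : OpenPartialHomeomorph M (Euc n)} {p : M}

theorem DivFreeWeb.IsWebConnection.eq_chartConn (hD : W.IsWebConnection D) (hn : 1 ≤ n)
    (hφ : W.IsAdaptedChart φ) (hp : p ∈ φ.source) {X : (p : M) → Tan n p}
    (hX : MDifferentiableAt 𝓘(ℝ, Euc n) 𝓘(ℝ, Euc n).tangent
      (fun q => (⟨q, X q⟩ : TangentBundle 𝓘(ℝ, Euc n) M)) p) :
    D X p = chartConn (W.logDensityPartial φ) φ X p :=
  (hD.isLocalWebConnection _).eq hn (hφ.isLocalWebConnection hn) hp hX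

theorem DivFreeWeb.IsWebConnection.eventuallyEq_chartConn (hD : W.IsWebConnection D) (hn : 1 ≤ n)
    (hφ : W.IsAdaptedChart φ) (hp : p ∈ φ.source) {X : (p : M) → Tan n p}
    (hX : ContMDiffAt 𝓘(ℝ, Euc n) 𝓘(ℝ, Euc n).tangent ∞
      (fun q => (⟨q, X q⟩ : TangentBundle 𝓘(ℝ, Euc n) M)) p) :
    ∀ᶠ q in 𝓝 p, D X q = chartConn (W.logDensityPartial φ) φ X q := by
  have : IsManifold 𝓘(ℝ, Euc n) 2 M := .of_le (n := ∞) two_le_infty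
  have : IsManifold 𝓘(ℝ, Euc n).tangent 2 (TangentBundle 𝓘(ℝ, Euc n) M) :=
    .of_le (n := ∞) two_le_infty
  -- Being of class C^m at a point is an open condition for finite `m` but not for `m = ∞`, so the
  -- order is lowered to 2.
  have h1 := (contMDiffAt_iff_contMDiffAt_nhds (n := 2) (by simp)).1
    (hX.of_le two_le_infty)
  filter_upwards [h1, φ.open_source.mem_nhds hp] with q hq hqφ
  exact hD.eq_chartConn hn hφ hqφ (hq.mdifferentiableAt (by simp))

/-- The outer derivative sees the inner field on a neighbourhood, so agreement of the two
connections near `p` is used. -/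
theorem DivFreeWeb.IsWebConnection.chartDeriv_second (hD : W.IsWebConnection D) (hn : 1 ≤ n)
    (hφ : W.IsAdaptedChart φ) (hp : p ∈ φ.source) {X Y : (p : M) → Tan n p}
    (hX : ContMDiffAt 𝓘(ℝ, Euc n) 𝓘(ℝ, Euc n).tangent ∞
      (fun q => (⟨q, X q⟩ : TangentBundle 𝓘(ℝ, Euc n) M)) p)
    (hY : ContMDiffAt 𝓘(ℝ, Euc n) 𝓘(ℝ, Euc n).tangent ∞
      (fun q => (⟨q, Y q⟩ : TangentBundle 𝓘(ℝ, Euc n) M)) p) (v : Tan n p) :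
    chartDeriv φ p (D (fun q => D X q (Y q)) p v) =
      coordConn (W.logDensityPartial φ)
        (fun x => coordConn (W.logDensityPartial φ) (chartRep φ X) x (chartRep φ Y x))
        (φ p) (chartDeriv φ p v) := by
  have hm := hφ.mem_atlas hn
  set γ := W.logDensityPartial φ with hγ
  have h1 := hD.eventuallyEq_chartConn hn hφ hp hX
  have h2 : ContMDiffAt 𝓘(ℝ, Euc n) 𝓘(ℝ, Euc n).tangent ∞
      (fun q => (⟨q, D X q (Y q)⟩ : TangentBundle 𝓘(ℝ, Euc n) M)) p := by
    refine (contMDiffAt_chartConn hm hp (fun k =>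
      W.contDiffAt_logDensityPartial hm (φ.map_source hp) k) hX hY).congr_of_eventuallyEq ?_
    filter_upwards [h1] with q hq
    rw [hq]
  rw [hD.eq_chartConn hn hφ hp (h2.mdifferentiableAt (by simp)), chartDeriv_chartConn hm _ _ hp]
  have h3 : chartRep φ (fun q => D X q (Y q)) =ᶠ[𝓝 (φ p)]
      fun x => coordConn γ (chartRep φ X) x (chartRep φ Y x) := by
    have h4 : ∀ᶠ x in 𝓝 (φ p), D X (φ.symm x) = chartConn γ φ X (φ.symm x) := by
      have h5 := φ.continuousAt_symm (φ.map_source hp)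
      rw [ContinuousAt, φ.left_inv hp] at h5
      exact h5.eventually h1
    filter_upwards [h4, φ.open_target.mem_nhds (φ.map_source hp)] with x hx hxt
    change chartDeriv φ (φ.symm x) (D X (φ.symm x) (Y (φ.symm x))) = _
    rw [hx, chartDeriv_chartConn hm _ _ (φ.map_target hxt), φ.right_inv hxt]
    rfl
  ext k
  rw [coordConn_apply, coordConn_apply, h3.fderiv_eq, h3.self_of_nhds]

theorem DivFreeWeb.IsWebConnection.chartDeriv_curvatureField (hD : W.IsWebConnection D)
    (hn : 1 ≤ n) (hφ : W.IsAdaptedChart φ) (hp : p ∈ φ.source) {X Y Z : (p : M) → Tan n p}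
    (hX : ContMDiffAt 𝓘(ℝ, Euc n) 𝓘(ℝ, Euc n).tangent ∞
      (fun q => (⟨q, X q⟩ : TangentBundle 𝓘(ℝ, Euc n) M)) p)
    (hY : ContMDiffAt 𝓘(ℝ, Euc n) 𝓘(ℝ, Euc n).tangent ∞
      (fun q => (⟨q, Y q⟩ : TangentBundle 𝓘(ℝ, Euc n) M)) p)
    (hZ : ContMDiffAt 𝓘(ℝ, Euc n) 𝓘(ℝ, Euc n).tangent ∞
      (fun q => (⟨q, Z q⟩ : TangentBundle 𝓘(ℝ, Euc n) M)) p) :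
    chartDeriv φ p (curvatureField D X Y Z p) =
      coordCurvature (W.logDensityPartial φ) (φ p) (chartDeriv φ p (X p))
        (chartDeriv φ p (Z p)) (chartDeriv φ p (Y p)) := by
  have hm := hφ.mem_atlas hn
  have hd : ∀ {V : (p : M) → Tan n p}, ContMDiffAt 𝓘(ℝ, Euc n) 𝓘(ℝ, Euc n).tangent ∞
      (fun q => (⟨q, V q⟩ : TangentBundle 𝓘(ℝ, Euc n) M)) p →
      MDifferentiableAt 𝓘(ℝ, Euc n) 𝓘(ℝ, Euc n).tangent
      (fun q => (⟨q, V q⟩ : TangentBundle 𝓘(ℝ, Euc n) M)) p :=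
    fun hV => hV.mdifferentiableAt (by simp)
  rw [curvatureField, map_sub, map_sub, hD.chartDeriv_second hn hφ hp hZ hY,
    hD.chartDeriv_second hn hφ hp hZ hX, hD.eq_chartConn hn hφ hp (hd hZ),
    chartDeriv_chartConn hm _ _ hp, chartRep_mlieBracket hm hp (hd hX) (hd hY),
    ← chartRep_apply X hp, ← chartRep_apply Y hp, ← chartRep_apply Z hp]
  ext k
  rw [PiLp.sub_apply, PiLp.sub_apply, coordCurvature_apply]
  exact coordConn_curvature
    (fun k => W.contDiffAt_logDensityPartial hm (φ.map_source hp) k)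
    (contDiffAt_chartRep hm hp hX) (contDiffAt_chartRep hm hp hY) (contDiffAt_chartRep hm hp hZ) k

theorem DivFreeWeb.IsWebConnection.chartDeriv_curvature (hD : W.IsWebConnection D)
    (hn : 1 ≤ n) (hφ : W.IsAdaptedChart φ) (hp : p ∈ φ.source) (u v w : Tan n p) :
    chartDeriv φ p (curvature D p u v w) =
      coordCurvature (W.logDensityPartial φ) (φ p) (chartDeriv φ p u)
        (chartDeriv φ p w) (chartDeriv φ p v) := by
  have h : ∀ v : Tan n p, ContMDiffAt 𝓘(ℝ, Euc n) 𝓘(ℝ, Euc n).tangent ∞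
      (fun q => (⟨q, FiberBundle.extend (Euc n) v q⟩ : TangentBundle 𝓘(ℝ, Euc n) M)) p :=
    fun v => FiberBundle.contMDiffAt_extend 𝓘(ℝ, Euc n) (Euc n) v
  rw [curvature, hD.chartDeriv_curvatureField hn hφ hp (h u) (h v) (h w),
    FiberBundle.extend_apply_self, FiberBundle.extend_apply_self, FiberBundle.extend_apply_self]

theorem DivFreeWeb.logDensityPartial_fderiv (W : DivFreeWeb n M) (k l : Fin n) (x : Euc n) :
    fderiv ℝ (W.logDensityPartial φ l) x (stdVec k) =
      secondPartial (fun x => Real.log |W.density φ x|) k l x := rfl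

theorem DivFreeWeb.IsWebConnection.ricci_eq (hD : W.IsWebConnection D)
    (hn : 1 ≤ n) (hφ : W.IsAdaptedChart φ) (hp : p ∈ φ.source) (u w : Tan n p) :
    ricci D p u w = W.nonuniformityIn φ p u w := by
  have hm := hφ.mem_atlas hn
  set T := coordCurvature (W.logDensityPartial φ) (φ p) (chartDeriv φ p u) (chartDeriv φ p w)
    with hT
  -- The trace in `ricci` uses the standard basis of the type `Euc n`, unrelated to `φ`; conjugating
  -- by the differential of `φ` does not change it.
  let A : Euc n →ₗ[ℝ] Euc n := (chartDeriv φ p).toLinearMap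
  let B : Euc n →ₗ[ℝ] Euc n := (chartInv φ p).toLinearMap
  have hAB : A ∘ₗ B = LinearMap.id := LinearMap.ext fun v => chartDeriv_chartInv hm hp v
  have h1 : ricci D p u w = LinearMap.trace ℝ (Euc n) (B ∘ₗ (T ∘ₗ A)) := by
    rw [trace_euclidean]
    refine Finset.sum_congr rfl fun j _ => ?_
    have h2 := hD.chartDeriv_curvature hn hφ hp u (stdVec j : Euc n) w
    have h3 := congrArg (chartInv φ p) h2
    rw [chartInv_chartDeriv hm hp] at h3
    rw [h3]
    rfl
  rw [h1, LinearMap.trace_comp_comm', LinearMap.comp_assoc, hAB, LinearMap.comp_id,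
    trace_euclidean, DivFreeWeb.nonuniformityIn, Finset.sum_comm]
  refine Finset.sum_congr rfl fun l _ => ?_
  have h4 : fderiv ℝ (W.logDensityPartial φ l) (φ p) (chartDeriv φ p u) =
      ∑ k, secondPartial (fun x => Real.log |W.density φ x|) k l (φ p) * coordDiff φ k p u := by
    conv_lhs => rw [← sum_smul_stdVec (chartDeriv φ p u), map_sum]
    refine Finset.sum_congr rfl fun k _ => ?_
    rw [map_smul, W.logDensityPartial_fderiv, smul_eq_mul, mul_comm]
    rfl
  -- The second term of the curvature contributes exactly the diagonal summand `k = l` of the first,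
  -- and the two cancel.
  rw [hT, coordCurvature_apply, h4, W.logDensityPartial_fderiv, stdVec_apply, if_pos rfl, mul_one,
    ← coordDiff_apply, ← coordDiff_apply, ← Finset.add_sum_erase _ _ (Finset.mem_univ l),
    add_sub_cancel_left, ← Finset.add_sum_erase _ _ (Finset.mem_univ l), if_pos rfl, zero_add,
    Finset.mul_sum]
  refine Finset.sum_congr rfl fun k hk => ?_
  rw [if_neg (Finset.ne_of_mem_erase hk)]
  ring

/-- Instead of transforming second derivatives, the expressions in both charts are identified with
the Ricci tensor of one web connection, which refers to no chart. -/
theorem DivFreeWeb.nonuniformity_eq (W : DivFreeWeb n M) (hn : 1 ≤ n) (hφ : W.IsAdaptedChart φ)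
    (hp : p ∈ φ.source) (v w : Tan n p) :
    W.nonuniformity p v w = W.nonuniformityIn φ p v w := by
  obtain ⟨D, hD⟩ := W.exists_isWebConnection hn
  have h : ∃ φ : OpenPartialHomeomorph M (Euc n), p ∈ φ.source ∧ W.IsAdaptedChart φ :=
    ⟨φ, hp, hφ⟩
  rw [DivFreeWeb.nonuniformity, dif_pos h, ← hD.ricci_eq hn hφ hp,
    ← hD.ricci_eq hn h.choose_spec.2 h.choose_spec.1]

theorem DivFreeWeb.IsWebConnection.ricci_eq_nonuniformity (hD : W.IsWebConnection D)
    (hn : 1 ≤ n) (p : M) (u w : Tan n p) : ricci D p u w = W.nonuniformity p u w := by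
  obtain ⟨φ, hp, -, hφ⟩ := W.exists_adaptedChart p
  rw [hD.ricci_eq hn hφ hp, W.nonuniformity_eq hn hφ hp]

theorem IsFlat.isRicciFlat (h : IsFlat D) : IsRicciFlat D := fun p u w =>
  Finset.sum_eq_zero fun j _ =>
  (congrArg (EuclideanSpace.proj j : Euc n →L[ℝ] ℝ) (h p u (stdVec j : Euc n) w)).trans
    (map_zero _)

theorem DivFreeWeb.IsWebConnection.secondPartial_eq_zero (hD : W.IsWebConnection D)
    (hn : 1 ≤ n) (h : IsRicciFlat D) (hφ : W.IsAdaptedChart φ) {k l : Fin n} (hkl : k ≠ l)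
    {x : Euc n} (hx : x ∈ φ.target) :
    secondPartial (fun x => Real.log |W.density φ x|) k l x = 0 := by
  have hm := hφ.mem_atlas hn
  have hp := φ.map_target hx
  have h1 := h (φ.symm x) (chartFrame φ k (φ.symm x)) (chartFrame φ l (φ.symm x))
  rw [hD.ricci_eq hn hφ hp, DivFreeWeb.nonuniformityIn, Finset.sum_eq_single k,
    Finset.sum_eq_single l, if_neg hkl, φ.right_inv hx, coordDiff_chartFrame hm hp,
    coordDiff_chartFrame hm hp] at h1
  · simpa using h1
  · intro b _ hb
    rw [coordDiff_chartFrame hm hp _ l]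
    simp [hb]
  · simp
  · intro b _ hb
    refine Finset.sum_eq_zero fun c _ => ?_
    rw [coordDiff_chartFrame hm hp _ k]
    simp [hb]
  · simp

/-- Vanishing mixed partials reduce `dγₖ` to a multiple of `dxₖ`, and then `dγₖ(a) bₖ - dγₖ(b) aₖ =
0`. -/
theorem DivFreeWeb.IsWebConnection.isFlat_of_isRicciFlat (hD : W.IsWebConnection D)
    (hn : 1 ≤ n) (h : IsRicciFlat D) : IsFlat D := by
  intro p u v w
  obtain ⟨φ, hp, -, hφ⟩ := W.exists_adaptedChart p
  have hm := hφ.mem_atlas hn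
  refine chartDeriv_injective hm hp ?_
  rw [hD.chartDeriv_curvature hn hφ hp, map_zero]
  have h1 : ∀ k (a : Euc n), fderiv ℝ (W.logDensityPartial φ k) (φ p) a =
      a k * fderiv ℝ (W.logDensityPartial φ k) (φ p) (stdVec k) := by
    intro k a
    conv_lhs => rw [← sum_smul_stdVec a, map_sum]
    rw [Finset.sum_eq_single k, map_smul, smul_eq_mul]
    · intro j _ hj
      rw [map_smul, W.logDensityPartial_fderiv,
        hD.secondPartial_eq_zero hn h hφ hj (φ.map_source hp), smul_zero]
    · simp
  ext k
  rw [coordCurvature_apply, h1 k (chartDeriv φ p u), h1 k (chartDeriv φ p v), PiLp.zero_apply]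
  ring

end Curvature

/-! ### Local triviality implies flatness. -/

section LocallyTrivialToFlat

variable {n : ℕ} {M : Type*} [TopologicalSpace M] [ChartedSpace (Euc n) M]
  [IsManifold 𝓘(ℝ, Euc n) ∞ M] {W : DivFreeWeb n M} {D : AffineConnection n M}

/-- A local equivalence with the standard web is, up to a permutation of the coordinates, an adapted
chart in which the volume form has constant coefficient `±1`. -/
theorem DivFreeWeb.LocallyEquivalentAt.exists_adaptedChart {p : M} {x₀ : Euc n}
    (h : W.LocallyEquivalentAt p (standardWeb n) x₀) :
    ∃ φ : OpenPartialHomeomorph M (Euc n), p ∈ φ.source ∧ W.IsAdaptedChart φ ∧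
      ∀ x ∈ φ.target, |W.density φ x| = 1 := by
  obtain ⟨Φ₀, hp, -, hsm, hsm', ⟨σ, hσ⟩, hvol⟩ := h
  -- Permuting the target coordinates makes the `j`-th coordinate transverse to `Fⱼ`.
  set P : Euc n ≃L[ℝ] Euc n :=
    (LinearIsometryEquiv.piLpCongrLeft 2 ℝ ℝ σ.symm).toContinuousLinearEquiv with hP
  have h₁ : ContMDiffOn 𝓘(ℝ, Euc n) 𝓘(ℝ, Euc n) ∞ (Φ₀.transHomeomorph P.toHomeomorph)
      (Φ₀.transHomeomorph P.toHomeomorph).source :=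
    (P : Euc n →L[ℝ] Euc n).contMDiff.comp_contMDiffOn hsm
  have h₂ : ContMDiffOn 𝓘(ℝ, Euc n) 𝓘(ℝ, Euc n) ∞ (Φ₀.transHomeomorph P.toHomeomorph).symm
      (Φ₀.transHomeomorph P.toHomeomorph).target :=
    hsm'.comp (P.symm : Euc n →L[ℝ] Euc n).contMDiff.contMDiffOn fun _ hx => hx
  obtain ⟨φ, hm, hpφ, hsub, hbox, hφ, -⟩ := exists_cubical_restriction _ h₁ h₂ hp
  have hsub' : φ.source ⊆ Φ₀.source := hsub
  have hφa : ∀ q j, φ q j = Φ₀ q (σ j) := fun q j => by rw [hφ]; rfl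
  have hfol : W.IsAdaptedChart φ := by
    intro j
    refine ⟨hm, hbox, fun x hx => Set.ext fun y => ⟨fun hy => ?_, ?_⟩⟩
    · have h1 : Φ₀ y ∈ leafIn (hyperplaneRel (σ j)) Φ₀.target (Φ₀ x) := by
        have h2 := hσ j x (hsub' hx)
        change _ = leafIn (hyperplaneRel (σ j)) _ _ at h2
        rw [← h2]
        exact ⟨y, leafIn_mono hsub' x hy, rfl⟩
      refine ⟨mem_of_mem_leafIn hy, ?_⟩
      rw [hφa, hφa]
      exact (rel_of_mem_leafIn h1).symm
    · rintro ⟨hy, hxy⟩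
      set C := φ.symm '' (φ.target ∩ {z | z j = φ x j}) with hC
      have hCp : IsPathConnected C := isPathConnected_symm_image φ
        (convex_slice hbox.convex j (φ x j)) ⟨φ x, φ.map_source hx, rfl⟩ Set.inter_subset_left
      have hxC : x ∈ C := ⟨φ x, ⟨φ.map_source hx, rfl⟩, φ.left_inv hx⟩
      have hyC : y ∈ C := ⟨φ y, ⟨φ.map_source hy, hxy⟩, φ.left_inv hy⟩
      have hCs : C ⊆ φ.source := by
        rintro _ ⟨z, hz, rfl⟩
        exact φ.map_target hz.1
      have hCc : ∀ z ∈ C, φ z j = φ x j := by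
        rintro _ ⟨z, hz, rfl⟩
        rw [φ.right_inv hz.1]
        exact hz.2
      have hCi : IsPathConnected (Φ₀ '' C) :=
        hCp.image' (Φ₀.continuousOn.mono (hCs.trans hsub'))
      refine (hCp.joinedIn x hxC y hyC).mono fun z hz => ⟨?_, hCs hz⟩
      -- The image of the slice is connected inside one hyperplane, so the leaf correspondence, with
      -- injectivity of `Φ₀`, puts `z` in the leaf of `x`.
      have h1 : Φ₀ z ∈ leafIn (hyperplaneRel (σ j)) Φ₀.target (Φ₀ x) := by
        refine (hCi.joinedIn _ ⟨x, hxC, rfl⟩ _ ⟨z, hz, rfl⟩).mono ?_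
        rintro _ ⟨w, hw, rfl⟩
        refine ⟨?_, Φ₀.map_source (hsub' (hCs hw))⟩
        have := hCc w hw
        rw [hφa, hφa] at this
        exact this.symm
      have h2 := hσ j x (hsub' hx)
      change _ = leafIn (hyperplaneRel (σ j)) _ _ at h2
      rw [← h2] at h1
      obtain ⟨w, hw, hwz⟩ := h1
      rw [← Φ₀.injOn (mem_of_mem_leafIn hw) (hsub' (hCs hz)) hwz]
      exact rel_of_mem_leafIn hw
  refine ⟨φ, hpφ, hfol, fun x hx => ?_⟩
  set q := φ.symm x with hq
  have hqs : q ∈ φ.source := φ.map_target hx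
  have hd : MDifferentiableAt 𝓘(ℝ, Euc n) 𝓘(ℝ, Euc n) Φ₀ q :=
    (hsm.contMDiffAt (Φ₀.open_source.mem_nhds (hsub' hqs))).mdifferentiableAt (by simp)
  set A : Tan n q →L[ℝ] Euc n := mfderiv 𝓘(ℝ, Euc n) 𝓘(ℝ, Euc n) Φ₀ q with hA
  have hcoord : ∀ j (v : Tan n q), coordDiff φ j q v = A v (σ j) := by
    intro j v
    have h1 : HasMFDerivAt 𝓘(ℝ, Euc n) 𝓘(ℝ, Euc n) φ q ((P : Euc n →L[ℝ] Euc n) ∘L A) := by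
      rw [hφ]
      exact (P : Euc n →L[ℝ] Euc n).hasMFDerivAt.comp q hd.hasMFDerivAt
    have h2 := congrArg (fun L : Tan n q →L[ℝ] Euc n => L v) h1.mfderiv
    exact congrArg (EuclideanSpace.proj j : Euc n →L[ℝ] ℝ) h2
  -- Permuting the rows of this Jacobian by `σ` gives the identity, so its determinant, which is the
  -- density, is the sign of `σ`.
  set N : Matrix (Fin n) (Fin n) ℝ := Matrix.of fun j k => A (chartFrame φ k q) j with hN
  have h1 : W.density φ x = N.det := by
    have h2 := W.density_apply hm hqs
    rw [hq, φ.right_inv hx] at h2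
    rw [h2]
    exact (hvol q (hsub' hqs) fun k => chartFrame φ k q).symm
  have h2 : (N.submatrix σ id).det = 1 := by
    have : N.submatrix σ id = 1 := by
      ext j k
      rw [Matrix.one_apply, ← coordDiff_chartFrame hm hqs j k, hcoord]
      rfl
    rw [this, Matrix.det_one]
  rw [Matrix.det_permute] at h2
  rw [h1]
  rcases Int.units_eq_one_or (Equiv.Perm.sign σ) with hs | hs <;> rw [hs] at h2
  · have h3 : N.det = 1 := by simpa using h2
    rw [h3, abs_one]
  · have h3 : -N.det = 1 := by simpa using h2
    rw [← abs_neg, h3, abs_one]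

theorem DivFreeWeb.nonuniformityIn_eq_zero_of_abs_density {φ : OpenPartialHomeomorph M (Euc n)}
    (h : ∀ x ∈ φ.target, |W.density φ x| = 1) {p : M} (hp : p ∈ φ.source) (v w : Tan n p) :
    W.nonuniformityIn φ p v w = 0 := by
  have h1 : (fun x => Real.log |W.density φ x|) =ᶠ[𝓝 (φ p)] fun _ => 0 := by
    filter_upwards [φ.open_target.mem_nhds (φ.map_source hp)] with x hx
    rw [h x hx, Real.log_one]
  have h2 : ∀ k l, secondPartial (fun x => Real.log |W.density φ x|) k l (φ p) = 0 := by
    intro k l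
    have h3 : (fun y => fderiv ℝ (fun x => Real.log |W.density φ x|) y (stdVec l))
        =ᶠ[𝓝 (φ p)] fun _ => 0 := by
      filter_upwards [h1.fderiv (𝕜 := ℝ)] with y hy
      rw [hy]
      simp
    rw [secondPartial, h3.fderiv_eq]
    simp
  simp only [DivFreeWeb.nonuniformityIn, h2, zero_mul, ite_self, Finset.sum_const_zero]

theorem DivFreeWeb.IsWebConnection.isFlat_of_isLocallyTrivial (hD : W.IsWebConnection D)
    (hn : 1 ≤ n) (h : W.IsLocallyTrivial) : IsFlat D := by
  refine hD.isFlat_of_isRicciFlat hn fun p u w => ?_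
  obtain ⟨φ, hp, hφ, h1⟩ := (h p).exists_adaptedChart
  rw [hD.ricci_eq hn hφ hp, W.nonuniformityIn_eq_zero_of_abs_density h1 hp]

end LocallyTrivialToFlat

/-! ### Separation of variables for the density. -/

section Separation

variable {n : ℕ}

theorem smul_stdVec_mem_box {a b : Fin n → ℝ} (h0 : ∀ k, a k < 0 ∧ 0 < b k) {k : Fin n} {t : ℝ}
    (ht : t ∈ Set.Ioo (a k) (b k)) :
    t • (stdVec k : Euc n) ∈ {x : Euc n | ∀ k, a k < x k ∧ x k < b k} := by
  intro j
  rw [PiLp.smul_apply, stdVec_apply]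
  split_ifs with hj
  · subst hj; simpa using ht
  · simpa using h0 j

/-- A function on a box whose mixed second partial derivatives vanish is a sum of functions of one
variable. -/
theorem eq_sum_of_secondPartial_eq_zero {a b : Fin n → ℝ} (h0 : ∀ k, a k < 0 ∧ 0 < b k)
    {f : Euc n → ℝ} (hf : ContDiffOn ℝ ∞ f {x : Euc n | ∀ k, a k < x k ∧ x k < b k})
    (h : ∀ k l, k ≠ l → ∀ x ∈ {x : Euc n | ∀ k, a k < x k ∧ x k < b k},
      secondPartial f k l x = 0)
    {x : Euc n} (hx : x ∈ {x : Euc n | ∀ k, a k < x k ∧ x k < b k}) :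
    f x - f 0 = ∑ k, (f (x k • stdVec k) - f 0) := by
  set B := {x : Euc n | ∀ k, a k < x k ∧ x k < b k} with hB
  have hBo : IsOpen B := isOpen_box
  have hBc : Convex ℝ B := convex_box
  have hat : ∀ y ∈ B, ContDiffAt ℝ ∞ f y := fun y hy => hf.contDiffAt (hBo.mem_nhds hy)
  have hpt : ∀ y ∈ B, ∀ k, y k • (stdVec k : Euc n) ∈ B := fun y hy k =>
    smul_stdVec_mem_box h0 (hy k)
  -- `∂ₖ f` depends on `yₖ` alone: the segment from `yₖ eₖ` to `y` has no `k`-th component, and all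
  -- other derivatives of `∂ₖ f` vanish.
  have hγ : ∀ k, ∀ y ∈ B, fderiv ℝ f y (stdVec k) = fderiv ℝ f (y k • stdVec k) (stdVec k) := by
    intro k y hy
    obtain ⟨z, hz, hzd⟩ := domain_mvt (f := fun y => fderiv ℝ f y (stdVec k)) (s := B)
      (f' := fun z => fderiv ℝ (fun y => fderiv ℝ f y (stdVec k)) z) (fun z hz =>
        ((((hat z hz).fderiv_right (m := ∞) (by simp)).clm_apply
          contDiffAt_const).differentiableAt (by simp)).hasFDerivAt.hasFDerivWithinAt)
      hBc (hpt y hy k) hy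
    have hzB : z ∈ B := hBc.segment_subset (hpt y hy k) hy hz
    rw [← sum_smul_stdVec (y - y k • (stdVec k : Euc n)), map_sum, Finset.sum_eq_zero,
      sub_eq_zero] at hzd
    · exact hzd
    · intro j _
      by_cases hj : j = k
      · subst hj
        simp [stdVec_apply]
      · rw [map_smul]
        exact (congrArg _ (h j k hj z hzB)).trans (smul_zero _)
  set L : Fin n → Euc n →L[ℝ] Euc n := fun k =>
    (EuclideanSpace.proj k : Euc n →L[ℝ] ℝ).smulRight (stdVec k : Euc n) with hL
  have hLa : ∀ k y, L k y = y k • (stdVec k : Euc n) := fun k y => rfl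
  have h0B : (0 : Euc n) ∈ B := fun k => by simpa using h0 k
  -- By `hγ`, the difference of `f` and the separated sum has zero derivative, so it keeps its value
  -- at the origin.
  obtain ⟨z, hz, hzd⟩ := domain_mvt (f := fun y => f y - ∑ k, (f (L k y) - f 0)) (s := B)
    (f' := fun z => fderiv ℝ f z - ∑ k, (fderiv ℝ f (L k z)).comp (L k))
    (fun z hz => by
      refine (((hat z hz).differentiableAt (by simp)).hasFDerivAt.sub
        (HasFDerivAt.fun_sum fun k _ => ?_)).hasFDerivWithinAt
      exact ((((hat _ (hpt z hz k)).differentiableAt (by simp)).hasFDerivAt).comp z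
        (L k).hasFDerivAt).sub_const _) hBc h0B hx
  have hzB : z ∈ B := hBc.segment_subset h0B hx hz
  have h1 : (fderiv ℝ f z - ∑ k, (fderiv ℝ f (L k z)).comp (L k)) (x - 0) = 0 := by
    rw [sub_apply, sum_apply, sub_zero]
    conv_lhs => enter [1]; rw [← sum_smul_stdVec x, map_sum]
    rw [← Finset.sum_sub_distrib]
    refine Finset.sum_eq_zero fun k _ => ?_
    rw [ContinuousLinearMap.comp_apply, hLa, hLa, map_smul, map_smul, hγ k z hzB, sub_self]
  rw [h1] at hzd
  simp only [hLa, PiLp.zero_apply, zero_smul, sub_self, Finset.sum_const_zero, sub_zero] at hzd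
  linarith

/-- A smooth positive function on an interval has a smooth increasing primitive. -/
theorem exists_primitive {a b : ℝ} (h0 : a < 0 ∧ 0 < b) {ρ : ℝ → ℝ}
    (hρ : ContDiffOn ℝ ∞ ρ (Set.Ioo a b)) (hpos : ∀ t ∈ Set.Ioo a b, 0 < ρ t) :
    ∃ G : ℝ → ℝ, G 0 = 0 ∧ (∀ t ∈ Set.Ioo a b, HasDerivAt G (ρ t) t) ∧
      ContDiffOn ℝ ∞ G (Set.Ioo a b) ∧ Set.InjOn G (Set.Ioo a b) := by
  have hG : ∀ t ∈ Set.Ioo a b, HasDerivAt (fun u => ∫ s in (0 : ℝ)..u, ρ s) (ρ t) t := by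
    intro t ht
    refine intervalIntegral.integral_hasDerivAt_right ?_ ?_
      (hρ.continuousOn.continuousAt (isOpen_Ioo.mem_nhds ht))
    · exact (hρ.continuousOn.mono (Set.ordConnected_Ioo.uIcc_subset h0 ht)).intervalIntegrable
    · exact hρ.continuousOn.stronglyMeasurableAtFilter isOpen_Ioo t ht
  refine ⟨fun u => ∫ s in (0 : ℝ)..u, ρ s, by simp, hG, ?_, ?_⟩
  · rw [contDiffOn_infty_iff_deriv_of_isOpen isOpen_Ioo]
    exact ⟨fun t ht => (hG t ht).differentiableAt.differentiableWithinAt,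
      hρ.congr fun t ht => (hG t ht).deriv⟩
  · refine (strictMonoOn_of_deriv_pos (convex_Ioo a b)
      (fun t ht => (hG t ht).continuousAt.continuousWithinAt) fun t ht => ?_).injOn
    rw [interior_Ioo] at ht
    rw [(hG t ht).deriv]
    exact hpos t ht

/-- A nowhere vanishing smooth function `h` on a box such that the mixed second partial derivatives
of `log |h|` vanish is a product of derivatives of functions of one variable. -/
theorem exists_prod_deriv_eq (hn : 1 ≤ n) {a b : Fin n → ℝ} (h0 : ∀ k, a k < 0 ∧ 0 < b k)
    {h : Euc n → ℝ} (hh : ContDiffOn ℝ ∞ h {x : Euc n | ∀ k, a k < x k ∧ x k < b k})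
    (hne : ∀ x ∈ {x : Euc n | ∀ k, a k < x k ∧ x k < b k}, h x ≠ 0)
    (hmix : ∀ k l, k ≠ l → ∀ x ∈ {x : Euc n | ∀ k, a k < x k ∧ x k < b k},
      secondPartial (fun x => Real.log |h x|) k l x = 0) :
    ∃ G ρ : Fin n → ℝ → ℝ, (∀ k, G k 0 = 0) ∧
      (∀ k, ∀ t ∈ Set.Ioo (a k) (b k), ρ k t ≠ 0 ∧ HasDerivAt (G k) (ρ k t) t) ∧
      (∀ k, ContDiffOn ℝ ∞ (G k) (Set.Ioo (a k) (b k))) ∧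
      (∀ k, Set.InjOn (G k) (Set.Ioo (a k) (b k))) ∧
      ∀ x ∈ {x : Euc n | ∀ k, a k < x k ∧ x k < b k}, ∏ k, ρ k (x k) = h x := by
  set B := {x : Euc n | ∀ k, a k < x k ∧ x k < b k} with hB
  set f : Euc n → ℝ := fun x => Real.log |h x| with hf
  have hfs : ContDiffOn ℝ ∞ f B := by
    simp only [hf, Real.log_abs]
    exact hh.log hne
  have h0B : (0 : Euc n) ∈ B := fun k => by simpa using h0 k
  set ρ : Fin n → ℝ → ℝ := fun k t => Real.exp (f (t • stdVec k) - f 0) with hρ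
  have hρs : ∀ k, ContDiffOn ℝ ∞ (ρ k) (Set.Ioo (a k) (b k)) := fun k =>
    ((hfs.comp (contDiff_id.smul contDiff_const).contDiffOn
      fun t ht => smul_stdVec_mem_box h0 ht).sub contDiffOn_const).exp
  choose G hG0 hGd hGs hGi using fun k => exists_primitive (h0 k) (hρs k)
    fun t _ => Real.exp_pos _
  -- The exponentials are positive and equal 1 at the origin, so the constant `h 0`, with its sign,
  -- goes into the first factor.
  set c : Fin n → ℝ := fun k => if k = ⟨0, hn⟩ then h 0 else 1 with hc
  have hc0 : ∀ k, c k ≠ 0 := by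
    intro k
    simp only [hc]
    split_ifs
    · exact hne 0 h0B
    · exact one_ne_zero
  have hcp : ∏ k, c k = h 0 := by simp [hc]
  refine ⟨fun k t => c k * G k t, fun k t => c k * ρ k t, fun k => by simp [hG0],
    fun k t ht => ⟨mul_ne_zero (hc0 k) (Real.exp_ne_zero _), (hGd k t ht).const_mul _⟩,
    fun k => contDiffOn_const.mul (hGs k),
    fun k s hs t ht hst => hGi k hs ht (mul_left_cancel₀ (hc0 k) hst), ?_⟩
  have hprod : ∀ x ∈ B, ∏ k, c k * ρ k (x k) = h 0 * Real.exp (f x - f 0) := by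
    intro x hx
    rw [Finset.prod_mul_distrib, hcp, eq_sum_of_secondPartial_eq_zero h0 hfs hmix hx,
      Real.exp_sum]
  -- The logarithm determines `h` only up to sign. The squares agree, and continuity on the
  -- connected box, nonvanishing of `h` and equality at 0 fix the sign.
  have hsq : Set.EqOn ((fun x => h 0 * Real.exp (f x - f 0)) ^ 2) (h ^ 2) B := by
    intro x hx
    have h1 : Real.exp (f x - f 0) = |h x| / |h 0| := by
      rw [Real.exp_sub, Real.exp_log (abs_pos.2 (hne x hx)), Real.exp_log (abs_pos.2 (hne 0 h0B))]
    have h2 := hne 0 h0B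
    simp only [Pi.pow_apply, h1, mul_pow, div_pow, sq_abs]
    field_simp
  have heq := (convex_box (a := a) (b := b)).isPreconnected.eq_of_sq_eq
    (continuousOn_const.mul (hfs.continuousOn.sub continuousOn_const).rexp) hh.continuousOn hsq
    (fun {x} hx => hne x hx) h0B
    (by
      change h 0 * Real.exp (f 0 - f 0) = h 0
      rw [sub_self, Real.exp_zero, mul_one])
  exact fun x hx => (hprod x hx).trans (heq hx)

end Separation

/-! ### Flatness implies local triviality. -/

section FlatToLocallyTrivial

variable {n : ℕ} {M : Type*} [TopologicalSpace M] [ChartedSpace (Euc n) M]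
  [IsManifold 𝓘(ℝ, Euc n) ∞ M] {W : DivFreeWeb n M} {D : AffineConnection n M}

/-- An adapted chart in which the volume form is the Lebesgue form is a local equivalence with the
standard web. -/
theorem DivFreeWeb.IsAdaptedChart.locallyEquivalentAt {ψ : OpenPartialHomeomorph M (Euc n)}
    (hψ : W.IsAdaptedChart ψ) (hn : 1 ≤ n) {p : M} (hp : p ∈ ψ.source)
    (hvol : ∀ q ∈ ψ.source, ∀ v : Fin n → Tan n q,
      W.vol q v = Matrix.det (fun j k => coordDiff ψ j q (v k))) :
    W.LocallyEquivalentAt p (standardWeb n) (ψ p) := by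
  have hm := hψ.mem_atlas hn
  refine ⟨ψ, hp, rfl, contMDiffOn_of_mem_maximalAtlas hm, contMDiffOn_symm_of_mem_maximalAtlas hm,
    ⟨1, fun j x hx => ?_⟩, fun q hq v => (hvol q hq v).symm⟩
  change _ = leafIn (hyperplaneRel j) ψ.target (ψ x)
  rw [(hψ j).plaque x hx]
  ext z
  constructor
  · rintro ⟨y, ⟨hy, hxy⟩, rfl⟩
    exact joinedIn_hyperplane j (hψ j).cubical.convex (ψ.map_source hx) (ψ.map_source hy) hxy.symm
  · intro hz
    have hzt := mem_of_mem_leafIn hz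
    refine ⟨ψ.symm z, ⟨ψ.map_target hzt, ?_⟩, ψ.right_inv hzt⟩
    rw [ψ.right_inv hzt]
    exact (rel_of_mem_leafIn hz).symm

/-- Replacing each `xₖ` by `Gₖ(xₖ)` preserves the level sets, since `Gₖ` is injective, and
multiplies `dx₁ ∧ ⋯ ∧ dxₙ` by `∏ Gₖ' = h`, which turns it into `Ω`. -/
theorem DivFreeWeb.IsWebConnection.isLocallyTrivial_of_isFlat (hD : W.IsWebConnection D)
    (hn : 1 ≤ n) (hflat : IsFlat D) : W.IsLocallyTrivial := by
  intro p
  obtain ⟨φ, hp, hp0, hφ⟩ := W.exists_adaptedChart p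
  have hm := hφ.mem_atlas hn
  obtain ⟨a, b, hbox⟩ := (hφ ⟨0, hn⟩).cubical
  have h0 : ∀ k, a k < 0 ∧ 0 < b k := by
    have h1 := φ.map_source hp
    rw [hp0, hbox] at h1
    exact fun k => by simpa using h1 k
  obtain ⟨G, ρ, hG0, hGd, hGs, hGi, hprod⟩ := exists_prod_deriv_eq (h := W.density φ) hn h0
    (by rw [← hbox]; exact W.contDiffOn_density hm)
    (by rw [← hbox]; exact fun x hx => W.density_ne_zero hm hx)
    (by rw [← hbox]; exact fun k l hkl x hx =>
      hD.secondPartial_eq_zero hn hflat.isRicciFlat hφ hkl hx)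
  have hmem : ∀ q ∈ φ.source, ∀ k, φ q k ∈ Set.Ioo (a k) (b k) := by
    intro q hq
    have h1 := φ.map_source hq
    rwa [hbox] at h1
  set f : M → Euc n := fun q => WithLp.toLp 2 fun k => G k (φ q k) with hf
  have hsm : ContMDiffOn 𝓘(ℝ, Euc n) 𝓘(ℝ, Euc n) ∞ f φ.source := by
    have h1 : ∀ k, ContMDiffOn 𝓘(ℝ, Euc n) 𝓘(ℝ, ℝ) ∞ (fun q => G k (φ q k)) φ.source := fun k =>
      (hGs k).contMDiffOn.comp ((EuclideanSpace.proj k : Euc n →L[ℝ] ℝ).contMDiff.comp_contMDiffOn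
        (contMDiffOn_of_mem_maximalAtlas hm)) fun q hq => hmem q hq k
    have h2 : ContMDiffOn 𝓘(ℝ, Euc n) 𝓘(ℝ, Fin n → ℝ) ∞ (fun q k => G k (φ q k)) φ.source :=
      contMDiffOn_pi_space.2 h1
    exact ((EuclideanSpace.equiv (Fin n) ℝ).symm :
      (Fin n → ℝ) →L[ℝ] Euc n).contMDiff.comp_contMDiffOn h2
  have hder : ∀ q ∈ φ.source, ∀ (v : Tan n q) k,
      EuclideanSpace.proj k (mfderiv 𝓘(ℝ, Euc n) 𝓘(ℝ, Euc n) f q v : Euc n) =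
        ρ k (φ q k) * coordDiff φ k q v := by
    intro q hq v k
    have h1 := hasMFDerivAt_coord
      (((hsm q hq).contMDiffAt (φ.open_source.mem_nhds hq)).mdifferentiableAt (by simp)) k
    have h2 := (hGd k _ (hmem q hq k)).2.hasFDerivAt.hasMFDerivAt.comp q (hasMFDerivAt_coord
      ((mdifferentiable_of_mem_maximalAtlas hm).mdifferentiableAt hq) k)
    have h3 := congrArg (fun L : Euc n →L[ℝ] ℝ => L v) (hasMFDerivAt_unique h1 h2)
    exact h3.trans (mul_comm _ _)
  -- The differential of `f` is diagonal with entries `ρₖ ≠ 0`, hence injective.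
  obtain ⟨ψ, hψ, hpψ, hsub, hψbox, hψf⟩ := exists_cubical_chart φ.open_source hp hsm
    fun q hq v hv => by
      refine chartDeriv_injective hm hq ?_
      ext k
      have h1 := (congrArg (EuclideanSpace.proj k : Euc n →L[ℝ] ℝ) hv).symm.trans (hder q hq v k)
      rw [map_zero]
      exact (mul_eq_zero.1 h1.symm).resolve_left (hGd k _ (hmem q hq k)).1
  have hadapted : W.IsAdaptedChart ψ := fun k => (hφ k).of_level_sets hψ hψbox hsub
    fun x hx y hy => by
      rw [hψf x hx, hψf y hy]
      exact (hGi k).eq_iff (hmem x (hsub hx) k) (hmem y (hsub hy) k)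
  have hψp : ψ p = 0 := by
    rw [hψf p hpψ]
    ext k
    simp [hf, hp0, hG0]
  rw [← hψp]
  refine hadapted.locallyEquivalentAt hn hpψ fun q hq v => ?_
  have hcd : ∀ k (u : Tan n q), coordDiff ψ k q u = ρ k (φ q k) * coordDiff φ k q u := by
    intro k u
    rw [← hder q (hsub hq) u k]
    have h1 : mfderiv 𝓘(ℝ, Euc n) 𝓘(ℝ, Euc n) ψ q = mfderiv 𝓘(ℝ, Euc n) 𝓘(ℝ, Euc n) f q := by
      refine Filter.EventuallyEq.mfderiv_eq ?_
      filter_upwards [ψ.open_source.mem_nhds hq] with x hx using hψf x hx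
    exact congrArg (fun L : Euc n →L[ℝ] Euc n => L u k) h1
  rw [W.vol_eq_density_mul_det hm (hsub hq), ← hprod _ (hmem q (hsub hq))]
  simp only [hcd]
  exact (Matrix.det_mul_column (fun k => ρ k (φ q k)) _).symm

end FlatToLocallyTrivial

end

/-! ### The theorem. -/

theorem mainTheorem9 (n : ℕ) (hn : 1 ≤ n) (M : Type*) [TopologicalSpace M] [T2Space M]
    [SecondCountableTopology M] [ChartedSpace (Euc n) M] [IsManifold 𝓘(ℝ, Euc n) ∞ M]
    (W : DivFreeWeb n M) :
    -- the nonuniformity tensor is well defined by its expression in adapted coordinates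
    ((∀ p : M, ∃ φ : OpenPartialHomeomorph M (Euc n),
        p ∈ φ.source ∧ φ p = 0 ∧ W.IsAdaptedChart φ) ∧
      (∀ φ : OpenPartialHomeomorph M (Euc n), W.IsAdaptedChart φ → ∀ p ∈ φ.source,
        ∀ v w : Tan n p, W.nonuniformity p v w = W.nonuniformityIn φ p v w)) ∧
    -- existence and uniqueness of the adapted connection
    (∃ D : AffineConnection n M, W.IsWebConnection D) ∧
    (∀ D D' : AffineConnection n M, W.IsWebConnection D → W.IsWebConnection D' →
      ∀ (X : (p : M) → Tan n p) (p : M),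
        MDifferentiableAt 𝓘(ℝ, Euc n) 𝓘(ℝ, Euc n).tangent
          (fun q => (⟨q, X q⟩ : TangentBundle 𝓘(ℝ, Euc n) M)) p → D X p = D' X p) ∧
    -- its Ricci tensor is the nonuniformity tensor, and the criteria for local triviality
    (∀ D : AffineConnection n M, W.IsWebConnection D →
      (∀ (p : M) (u w : Tan n p), ricci D p u w = W.nonuniformity p u w) ∧
      (W.IsLocallyTrivial ↔ IsFlat D) ∧ (IsFlat D ↔ IsRicciFlat D)) := by
  refine ⟨⟨W.exists_adaptedChart, fun φ hφ p hp v w => W.nonuniformity_eq hn hφ hp v w⟩,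
    W.exists_isWebConnection hn, fun D D' hD hD' X p hX => ?_, fun D hD => ⟨?_, ⟨?_, ?_⟩, ?_⟩⟩
  · exact (hD.isLocalWebConnection _).eq hn (hD'.isLocalWebConnection _) (Set.mem_univ p) hX
  · exact hD.ricci_eq_nonuniformity hn
  · exact hD.isFlat_of_isLocallyTrivial hn
  · exact hD.isLocallyTrivial_of_isFlat hn
  · exact ⟨IsFlat.isRicciFlat, hD.isFlat_of_isRicciFlat hn⟩
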